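/- **Setting.** Let $d\in\{2,3\}$, $\epsilon>0$, $T>0$, $\Omega=\{x\in\mathbb R^d: x_1>0\}$, $\Sigma=\{x_1=0\}$, $x'=(x_2,\dots,x_d)$. Let $\chi\in C_0^\infty(\mathbb R;[0,1])$ satisfy $4\|\chi'\|_{L^\infty}<1$ and $\chi=1$ on $[-1,1]$. For $\varphi=\varphi(t,x')$ put $N=(1,-\partial_2\varphi,\dots,-\partial_d\varphi)$ and $\Phi^\pm(t,x)=\pm x_1+\chi(x_1)\varphi(t,x')$, and for $\Phi=\Phi^\pm$ let $\partial_1^{\Phi}=\frac{1}{\partial_1\Phi}\partial_1$, $\partial_j^{\Phi}=\partial_j-\frac{\partial_j\Phi}{\partial_1\Phi}\partial_1$ $(2\le j\le d)$, $\nabla^\Phi=(\partial^\Phi_1,\dots,\partial^\Phi_d)$. *Constitutive relations.* $\rho=\rho(p,S)>0$ and $\mathfrak e=\mathfrak e(p,S)$ are smooth on an open set $D$ of pairs $(p,S)$ and satisfy there $\vartheta\,dS=d\mathfrak e-\frac{p}{\rho^2}d\rho$ with some $\vartheta=\vartheta(p,S)>0$. Put $\mathfrak f=1+\epsilon^2(\mathfrak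 e+p/\rho)$ and $a^2=\partial p/\partial\rho=(\partial\rho/\partial p)^{-1}$ (at constant $S$). For fixed constants $\rho_*,\rho^*\ge 0$, it is assumed that $a^2>0$ and $0<\sqrt{a^2/\mathfrak f}<\epsilon^{-1}$ whenever $(p,S)\in D$ and $\rho_*<\rho(p,S)<\rho^*$. *Plasma.* For $U=(q,v,H,S)\in\mathbb R\times\mathbb R^d\times\mathbb R^d\times\mathbb R$ with $|v|<\epsilon^{-1}$ let $\Gamma=(1-\epsilon^2|v|^2)^{-1/2}$, $|b|^2=\epsilon^2\big(\Gamma^{-2}|H|^2+\epsilon^2(v\cdot H)^2\big)$, let $p=q-\frac{|H|^2}{2\Gamma^2}-\frac{\epsilon^2}{2}(v\cdot H)^2$, and evaluate $\rho$, $\mathfrak f$, $a^2$ at $(p,S)$. With $e_j$ the $j$-th unit vector, let $$\mathcal M_0=\Gamma^{-1}(I+\epsilon^2\Gamma^2v\otimes v),\qquad \mathcal N_j=\{\Gamma^{-2}H+\epsilon^2(v\cdot H)v\}\otimes(e_j-\epsilon^2v_jv)-\Gamma^{-2}H_jI,$$ $$\mathcal A_0=\big(\rho\mathfrak f\Gamma+\epsilon^2\Gamma^{-1}|H|^2\big)(I-\epsilon^2v\otimes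 v)-\epsilon^2\Gamma^{-1}(|b|^2v\otimes v+H\otimes H)+\epsilon^4\Gamma^{-1}(v\cdot H)(H\otimes v+v\otimes H),$$ $$\begin{aligned}\mathcal A_j={}&v_j\big\{(\rho\mathfrak f\Gamma+\epsilon^2\Gamma^{-1}|H|^2)(I-\epsilon^2v\otimes v)+\epsilon^2\Gamma^{-1}(|b|^2v\otimes v-H\otimes H)\big\}\\&+\epsilon^2\Gamma^{-1}H_j\big\{\Gamma^{-2}(H\otimes v+v\otimes H)-2(v\cdot H)(I-\epsilon^2v\otimes v)\big\}\\&+\Gamma^{-1}\{\epsilon^2(v\cdot H)H-|b|^2v\}\otimes e_j+\Gamma^{-1}e_j\otimes\{\epsilon^2(v\cdot H)H-|b|^2v\},\end{aligned}$$ $$B_0=\begin{bmatrix}\frac{\Gamma}{\rho a^2}&\epsilon^2v^{\mathsf T}&0&0\\ \epsilon^2v&\mathcal A_0&0&0\\0&0&\mathcal M_0&0\\0&0&0&1\end{bmatrix},\quad B_j=\begin{bmatrix}\frac{\Gamma v_j}{\rho a^2}&e_j^{\mathsf T}&0&0\\e_j&\mathcal A_j&\mathcal N_j^{\mathsf T}&0\\0&\mathcal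 N_j&v_j\mathcal M_0&0\\0&0&0&v_j\end{bmatrix},$$ $$J=\begin{bmatrix}1&(\epsilon^2|H|^2v-\epsilon^2(v\cdot H)H)^{\mathsf T}&-(\Gamma^{-2}H+\epsilon^2(v\cdot H)v)^{\mathsf T}&0\\0&\Gamma^2\mathcal M_0&0&0\\0&0&I&0\\0&0&0&1\end{bmatrix},\qquad A_j^+(U)=J^{-1}B_0^{-1}B_jJ .$$ *Vacuum.* $u=(h,e)$ with $h\in\mathbb R^d$, and $e\in\mathbb R^3$ if $d=3$, $e\in\mathbb R$ if $d=2$. The matrices $A_j^-(\nu)$ are those for which $\epsilon\partial_tu+\sum_{j=1}^dA_j^-(\nu)\partial_ju=0$ is the system $$\epsilon\partial_th+\nabla\times e+\epsilon(\nabla\cdot h)\nu=0,\qquad \epsilon\partial_te-\nabla\times h+\epsilon(\nabla\cdot e)\nu=0\quad(d=3),$$ $$\epsilon\partial_th+(\partial_2e,-\partial_1e)+\epsilon(\nabla\cdot h)\nu=0,\qquad \epsilon\partial_te-(\partial_1h_2-\partial_2h_1)=0\quad(d=2).$$ *The fixed-domain problem.* A solution on $[0,T]$ with initial data $(U_0,u_0,\varphi_0)$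 consists of $U=(q,v,H,S)$ and $u=(h,e)$, of class $C^2$ on $[0,T]\times\overline\Omega$, of $\varphi$ of class $C^2$ on $[0,T]\times\mathbb R^{d-1}$ with $|\varphi|\le2$, and of a field $\nu$ of class $C^1$ on $[0,T]\times\overline\Omega$, with values in $\mathbb R^d$, such that $\nu=v$ on $[0,T]\times\Sigma$ and, on $[0,T]\times\Omega$, $|\nu|<\epsilon^{-1}$, $|v|<\epsilon^{-1}$, $(p,S)\in D$ and $\rho_*<\rho<\rho^*$. It satisfies $(U,u,\varphi)|_{t=0}=(U_0,u_0,\varphi_0)$, the equations $$\partial_tU+\frac1{\partial_1\Phi^+}\Big(-\partial_t\Phi^+I+A_1^+(U)-\sum_{j=2}^d\partial_j\Phi^+A_j^+(U)\Big)\partial_1U+\sum_{j=2}^dA_j^+(U)\partial_jU=0,$$ $$\epsilon\partial_tu+\frac1{\partial_1\Phi^-}\Big(-\epsilon\partial_t\Phi^-I+A_1^-(\nu)-\sum_{j=2}^d\partial_j\Phi^-A_j^-(\nu)\Big)\partial_1u+\sum_{j=2}^dA_j^-(\nu)\partial_ju=0$$ in $[0,T]\times\Omega$, and on $[0,T]\times\Sigma$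 the boundary conditions $\partial_t\varphi=v\cdot N$, $2q=|h|^2-|e|^2$ and $$e_2+\partial_2\varphi\,e_1=\epsilon\,\partial_t\varphi\,h_3,\quad e_3+\partial_3\varphi\,e_1=-\epsilon\,\partial_t\varphi\,h_2\quad(d=3),\qquad e=-\epsilon\,\partial_t\varphi\,h_2\quad(d=2).$$ **Proposition.** For every such solution, each of the following constraints holds for all $t\in[0,T]$ provided that it holds at $t=0$: $$\nabla^{\Phi^+}\cdot H=0\ \text{ in }\Omega,\qquad \nabla^{\Phi^-}\cdot h=0\ \text{ in }\Omega,\qquad H\cdot N=0\ \text{ on }\Sigma,\qquad h\cdot N=0\ \text{ on }\Sigma,$$ and, if $d=3$, also $\nabla^{\Phi^-}\cdot e=0$ in $\Omega$. In particular, if all of them hold initially, then all of them hold on $[0,T]$. -/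

import Mathlib

open Set
open scoped Matrix ContDiff

noncomputable section

namespace PlasmaVacuum

/-! ### Space-time domains and derivatives up to the boundary

The space dimension is `d = n + 1`, a point of `ℝᵈ` is `x : Fin (n + 1) → ℝ`, its first coordinate
`x₁` is `x 0` and `x' = (x₂, …, x_d)` is `Fin.tail x : Fin n → ℝ`.  Only the topology of
`Fin k → ℝ` is used; Euclidean lengths are written through the dot product. -/

/-- Euclidean length. -/
def eucl {k : ℕ} (w : Fin k → ℝ) : ℝ := Real.sqrt (w ⬝ᵥ w)

/-- The open half space `Ω = {x₁ > 0}`. -/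
def halfSpace (n : ℕ) : Set (Fin (n + 1) → ℝ) := {x | 0 < x 0}

/-- The closed half space `{x₁ ≥ 0}`, the closure of `Ω`. -/
def closedHalfSpace (n : ℕ) : Set (Fin (n + 1) → ℝ) := {x | 0 ≤ x 0}

/-- The point `(0, x')` of the boundary `Σ = {0} × ℝⁿ`. -/
def bdryPt {n : ℕ} (x' : Fin n → ℝ) : Fin (n + 1) → ℝ := Fin.cons 0 x'

/-- `[0,T] × closure Ω`. -/
def slab (n : ℕ) (T : ℝ) : Set (ℝ × (Fin (n + 1) → ℝ)) := Icc 0 T ×ˢ closedHalfSpace n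

/-- `[0,T] × ℝⁿ`, on which the interface function lives. -/
def bdrySlab (n : ℕ) (T : ℝ) : Set (ℝ × (Fin n → ℝ)) := Icc 0 T ×ˢ univ

section Derivatives

variable {k : ℕ} {E : Type*} [NormedAddCommGroup E] [NormedSpace ℝ E]

/-- `∂ₜ f` on `D` (one-sided at the boundary of `D`). -/
def dt (D : Set (ℝ × (Fin k → ℝ))) (f : ℝ × (Fin k → ℝ) → E) (z : ℝ × (Fin k → ℝ)) : E :=
  fderivWithin ℝ f D z (1, 0)

/-- The partial derivative of `f` on `D` in the `i`-th space direction. -/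
def dx (D : Set (ℝ × (Fin k → ℝ))) (i : Fin k) (f : ℝ × (Fin k → ℝ) → E)
    (z : ℝ × (Fin k → ℝ)) : E :=
  fderivWithin ℝ f D z (0, Pi.single i 1)

end Derivatives

/-! ### Lifting of the interface -/

/-- The cut-off function: `χ ∈ C₀^∞(ℝ; [0,1])`, `4 ‖χ'‖_∞ < 1`, `χ = 1` on `[-1,1]`.
(Since `χ'` is continuous with compact support, the pointwise bound is the bound on its
supremum.) -/
structure IsCutoff (χ : ℝ → ℝ) : Prop where
  smooth : ContDiff ℝ ∞ χ
  compactSupport : HasCompactSupport χ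
  mem_Icc : ∀ s, χ s ∈ Icc (0 : ℝ) 1
  deriv_lt : ∀ s, 4 * |deriv χ s| < 1
  eq_one : ∀ s ∈ Icc (-1 : ℝ) 1, χ s = 1

/-- `Φ^±(t,x) = ± x₁ + χ(x₁) φ(t,x')`; the sign is `s = 1` or `s = -1`. -/
def lift {n : ℕ} (χ : ℝ → ℝ) (φ : ℝ × (Fin n → ℝ) → ℝ) (s : ℝ)
    (z : ℝ × (Fin (n + 1) → ℝ)) : ℝ :=
  s * z.2 0 + χ (z.2 0) * φ (z.1, Fin.tail z.2)

/-- The components of `∇^Φ`: `∂₁^Φ = ∂₁ / ∂₁Φ` and `∂ⱼ^Φ = ∂ⱼ - (∂ⱼΦ / ∂₁Φ) ∂₁` for `j ≥ 2`. -/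
def dxLift {n : ℕ} (D : Set (ℝ × (Fin (n + 1) → ℝ))) (Φ : ℝ × (Fin (n + 1) → ℝ) → ℝ)
    (i : Fin (n + 1)) (f : ℝ × (Fin (n + 1) → ℝ) → ℝ) (z : ℝ × (Fin (n + 1) → ℝ)) : ℝ :=
  if i = 0 then dx D 0 f z / dx D 0 Φ z
  else dx D i f z - dx D i Φ z / dx D 0 Φ z * dx D 0 f z

/-- `∇^Φ · F`. -/
def divLift {n : ℕ} (D : Set (ℝ × (Fin (n + 1) → ℝ))) (Φ : ℝ × (Fin (n + 1) → ℝ) → ℝ)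
    (F : ℝ × (Fin (n + 1) → ℝ) → Fin (n + 1) → ℝ) (z : ℝ × (Fin (n + 1) → ℝ)) : ℝ :=
  ∑ i, dxLift D Φ i (fun y => F y i) z

/-- `N = (1, -∂₂φ, …, -∂_dφ)`. -/
def normalN {n : ℕ} (T : ℝ) (φ : ℝ × (Fin n → ℝ) → ℝ) (z : ℝ × (Fin n → ℝ)) :
    Fin (n + 1) → ℝ :=
  Fin.cons 1 fun j => -dx (bdrySlab n T) j φ z

/-- The quasilinear operator in the fixed domain,
`c ∂ₜW + (∂₁Φ)⁻¹ (-c ∂ₜΦ I + A₁ - ∑_{j ≥ 2} ∂ⱼΦ Aⱼ) ∂₁W + ∑_{j ≥ 2} Aⱼ ∂ⱼW`,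
for matrices `A₁, …, A_d` depending on the point; `A 0` is `A₁`. -/
def opL {n : ℕ} {ι : Type} [Fintype ι] [DecidableEq ι] (D : Set (ℝ × (Fin (n + 1) → ℝ))) (c : ℝ)
    (A : ℝ × (Fin (n + 1) → ℝ) → Fin (n + 1) → Matrix ι ι ℝ)
    (Φ : ℝ × (Fin (n + 1) → ℝ) → ℝ) (W : ℝ × (Fin (n + 1) → ℝ) → ι → ℝ)
    (z : ℝ × (Fin (n + 1) → ℝ)) : ι → ℝ :=
  c • dt D W z
    + ((dx D 0 Φ z)⁻¹ •
        (-(c * dt D Φ z) • (1 : Matrix ι ι ℝ) + A z 0 - ∑ j : Fin n, dx D j.succ Φ z • A z j.succ))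
      *ᵥ dx D 0 W z
    + ∑ j : Fin n, A z j.succ *ᵥ dx D j.succ W z

/-! ### Constitutive relations -/

/-- Constitutive relations `ρ = ρ(p,S)`, `𝔢 = 𝔢(p,S)`, absolute temperature `ϑ = ϑ(p,S)`, given
for `(p,S)` in a set `domain`, and the density bounds `ρ_*`, `ρ^*`. -/
structure Constitutive where
  domain : Set (ℝ × ℝ)
  dens : ℝ × ℝ → ℝ
  energy : ℝ × ℝ → ℝ
  temp : ℝ × ℝ → ℝ
  densLo : ℝ
  densHi : ℝ

namespace Constitutive

variable (c : Constitutive)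

/-- `(p,S)` belongs to the domain of the constitutive relations and `ρ_* < ρ(p,S) < ρ^*`. -/
def Hyperbolic (y : ℝ × ℝ) : Prop :=
  y ∈ c.domain ∧ c.densLo < c.dens y ∧ c.dens y < c.densHi

/-- The index of the fluid `𝔣 = 1 + ε² (𝔢 + p/ρ)`. -/
def index (ε : ℝ) (y : ℝ × ℝ) : ℝ := 1 + ε ^ 2 * (c.energy y + y.1 / c.dens y)

/-- `a² = ∂p/∂ρ` at constant entropy, the inverse of `∂ρ/∂p`. -/
def aSq (y : ℝ × ℝ) : ℝ := (fderiv ℝ c.dens y (1, 0))⁻¹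

/-- The relativistic sound speed `c_s = √(𝔣⁻¹ ∂p/∂ρ)`. -/
def soundSpeed (ε : ℝ) (y : ℝ × ℝ) : ℝ := Real.sqrt ((c.index ε y)⁻¹ * c.aSq y)

/-- The assumptions on the constitutive relations: smoothness, the Gibbs relation
`ϑ dS = d𝔢 - (p/ρ²) dρ` with `ϑ > 0`, and `∂p/∂ρ > 0`, `0 < c_s < ε⁻¹` for `ρ_* < ρ < ρ^*`. -/
structure Admissible (ε : ℝ) : Prop where
  isOpen_domain : IsOpen c.domain
  dens_smooth : ContDiffOn ℝ ∞ c.dens c.domain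
  energy_smooth : ContDiffOn ℝ ∞ c.energy c.domain
  dens_pos : ∀ y ∈ c.domain, 0 < c.dens y
  temp_pos : ∀ y ∈ c.domain, 0 < c.temp y
  gibbs : ∀ y ∈ c.domain,
    c.temp y • ContinuousLinearMap.snd ℝ ℝ ℝ
      = fderiv ℝ c.energy y - (y.1 / c.dens y ^ 2) • fderiv ℝ c.dens y
  densLo_nonneg : 0 ≤ c.densLo
  densHi_nonneg : 0 ≤ c.densHi
  aSq_pos : ∀ y, c.Hyperbolic y → 0 < c.aSq y
  soundSpeed_pos : ∀ y, c.Hyperbolic y → 0 < c.soundSpeed ε y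
  soundSpeed_lt : ∀ y, c.Hyperbolic y → c.soundSpeed ε y < ε⁻¹

end Constitutive

/-! ### The plasma: the unknown `U = (q, v, H, S) ∈ ℝ^(2d+2)` -/

/-- Index set of the components `(q, v, H, S)`. -/
abbrev PIdx (d : ℕ) : Type := Fin 1 ⊕ Fin d ⊕ Fin d ⊕ Fin 1

section Plasma

variable {d : ℕ}

/-- Total pressure. -/
def qC (U : PIdx d → ℝ) : ℝ := U (.inl 0)

/-- Velocity. -/
def vC (U : PIdx d → ℝ) : Fin d → ℝ := fun i => U (.inr (.inl i))

/-- Magnetic field. -/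
def HC (U : PIdx d → ℝ) : Fin d → ℝ := fun i => U (.inr (.inr (.inl i)))

/-- Entropy. -/
def sC (U : PIdx d → ℝ) : ℝ := U (.inr (.inr (.inr 0)))

/-- The matrix with 4 × 4 blocks acting on `(scalar, vector, vector, scalar)`, whose last row and
column vanish off the diagonal. -/
def blockMat (a : ℝ) (r₂ r₃ : Fin d → ℝ) (c₂ : Fin d → ℝ) (M₂₂ M₂₃ : Matrix (Fin d) (Fin d) ℝ)
    (M₃₂ M₃₃ : Matrix (Fin d) (Fin d) ℝ) (s : ℝ) : Matrix (PIdx d) (PIdx d) ℝ :=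
  Matrix.of fun i j =>
    match i, j with
    | .inl _, .inl _ => a
    | .inl _, .inr (.inl j) => r₂ j
    | .inl _, .inr (.inr (.inl j)) => r₃ j
    | .inr (.inl i), .inl _ => c₂ i
    | .inr (.inl i), .inr (.inl j) => M₂₂ i j
    | .inr (.inl i), .inr (.inr (.inl j)) => M₂₃ i j
    | .inr (.inr (.inl i)), .inr (.inl j) => M₃₂ i j
    | .inr (.inr (.inl i)), .inr (.inr (.inl j)) => M₃₃ i j
    | .inr (.inr (.inr _)), .inr (.inr (.inr _)) => s
    | _, _ => 0

/-- `u ⊗ w = (uᵢ wⱼ)`. -/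
def tens (u w : Fin d → ℝ) : Matrix (Fin d) (Fin d) ℝ := Matrix.vecMulVec u w

/-- The unit vector `eⱼ`. -/
def unitVec (j : Fin d) : Fin d → ℝ := Pi.single j 1

variable (ε : ℝ) (U : PIdx d → ℝ)

/-- The Lorentz factor `Γ = 1 / √(1 - ε²|v|²)`. -/
def lorentz : ℝ := 1 / Real.sqrt (1 - ε ^ 2 * (vC U ⬝ᵥ vC U))

/-- `|b|² = ε² (Γ⁻² |H|² + ε² (v·H)²)`, so that `q = p + ½ ε⁻² |b|²`. -/
def bSq : ℝ :=
  ε ^ 2 * ((HC U ⬝ᵥ HC U) / lorentz ε U ^ 2 + ε ^ 2 * (vC U ⬝ᵥ HC U) ^ 2)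

/-- The pressure, determined by `q = p + |H|²/(2Γ²) + ½ ε² (v·H)²`. -/
def pressure : ℝ :=
  qC U - ((HC U ⬝ᵥ HC U) / (2 * lorentz ε U ^ 2) + ε ^ 2 / 2 * (vC U ⬝ᵥ HC U) ^ 2)

/-- The thermodynamic variables `(p, S)`. -/
def thermo : ℝ × ℝ := (pressure ε U, sC U)

/-- `𝓜₀ = Γ⁻¹ (I + ε² Γ² v ⊗ v)`. -/
def M0 : Matrix (Fin d) (Fin d) ℝ :=
  (lorentz ε U)⁻¹ • (1 + (ε ^ 2 * lorentz ε U ^ 2) • tens (vC U) (vC U))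

/-- `𝓝ⱼ = (Γ⁻² H + ε² (v·H) v) ⊗ (eⱼ - ε² vⱼ v) - Γ⁻² Hⱼ I`. -/
def Nj (j : Fin d) : Matrix (Fin d) (Fin d) ℝ :=
  tens (((lorentz ε U) ^ 2)⁻¹ • HC U + (ε ^ 2 * (vC U ⬝ᵥ HC U)) • vC U)
      (unitVec j - (ε ^ 2 * vC U j) • vC U)
    - (((lorentz ε U) ^ 2)⁻¹ * HC U j) • 1

variable (c : Constitutive)

/-- `ρ 𝔣 Γ + ε² Γ⁻¹ |H|²`. -/
def inertia : ℝ :=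
  c.dens (thermo ε U) * c.index ε (thermo ε U) * lorentz ε U
    + ε ^ 2 * (lorentz ε U)⁻¹ * (HC U ⬝ᵥ HC U)

/-- `𝓐₀`. -/
def A0 : Matrix (Fin d) (Fin d) ℝ :=
  inertia ε U c • (1 - ε ^ 2 • tens (vC U) (vC U))
    - (ε ^ 2 * (lorentz ε U)⁻¹) • (bSq ε U • tens (vC U) (vC U) + tens (HC U) (HC U))
    + (ε ^ 4 * (lorentz ε U)⁻¹ * (vC U ⬝ᵥ HC U)) •
        (tens (HC U) (vC U) + tens (vC U) (HC U))

/-- `ε² (v·H) H - |b|² v`. -/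
def auxVec : Fin d → ℝ := (ε ^ 2 * (vC U ⬝ᵥ HC U)) • HC U - bSq ε U • vC U

/-- `𝓐ⱼ`. -/
def Aj (j : Fin d) : Matrix (Fin d) (Fin d) ℝ :=
  vC U j •
      (inertia ε U c • (1 - ε ^ 2 • tens (vC U) (vC U))
        + (ε ^ 2 * (lorentz ε U)⁻¹) • (bSq ε U • tens (vC U) (vC U) - tens (HC U) (HC U)))
    + (ε ^ 2 * (lorentz ε U)⁻¹ * HC U j) •
        (((lorentz ε U) ^ 2)⁻¹ • (tens (HC U) (vC U) + tens (vC U) (HC U))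
          - (2 * (vC U ⬝ᵥ HC U)) • (1 - ε ^ 2 • tens (vC U) (vC U)))
    + (lorentz ε U)⁻¹ • tens (auxVec ε U) (unitVec j)
    + (lorentz ε U)⁻¹ • tens (unitVec j) (auxVec ε U)

/-- `B₀(V)`, the coefficient of `∂ₜV` in the symmetric system for `V = (p, Γv, H, S)`. -/
def B0 : Matrix (PIdx d) (PIdx d) ℝ :=
  blockMat (lorentz ε U / (c.dens (thermo ε U) * c.aSq (thermo ε U)))
    (ε ^ 2 • vC U) 0 (ε ^ 2 • vC U) (A0 ε U c) 0 0 (M0 ε U) 1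

/-- `Bⱼ(V)`, the coefficient of `∂ⱼV` in the symmetric system for `V = (p, Γv, H, S)`. -/
def Bj (j : Fin d) : Matrix (PIdx d) (PIdx d) ℝ :=
  blockMat (lorentz ε U * vC U j / (c.dens (thermo ε U) * c.aSq (thermo ε U)))
    (unitVec j) 0 (unitVec j) (Aj ε U c j) (Nj ε U j)ᵀ (Nj ε U j) (vC U j • M0 ε U) (vC U j)

/-- `J = ∂V/∂U`. -/
def Jmat : Matrix (PIdx d) (PIdx d) ℝ :=
  blockMat 1
    ((ε ^ 2 * (HC U ⬝ᵥ HC U)) • vC U - (ε ^ 2 * (vC U ⬝ᵥ HC U)) • HC U)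
    (-(((lorentz ε U) ^ 2)⁻¹ • HC U + (ε ^ 2 * (vC U ⬝ᵥ HC U)) • vC U))
    0 (lorentz ε U ^ 2 • M0 ε U) 0 0 1 1

/-- `Aⱼ⁺(U) = J⁻¹ B₀⁻¹ Bⱼ J`. -/
def Aplus (j : Fin d) : Matrix (PIdx d) (PIdx d) ℝ :=
  (Jmat ε U)⁻¹ * (B0 ε U c)⁻¹ * Bj ε U c j * Jmat ε U

end Plasma

/-! ### The vacuum: the unknown `u = (h, e)`, in `ℝ⁶` for `d = 3` and in `ℝ³` for `d = 2` -/

/-- `A₁⁻(ν), A₂⁻(ν), A₃⁻(ν)` for `d = 3`. -/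
def Aminus3 (ε : ℝ) (ν : Fin 3 → ℝ) : Fin 3 → Matrix (Fin 6) (Fin 6) ℝ :=
  ![!![ε * ν 0, 0, 0, 0, 0, 0;
       ε * ν 1, 0, 0, 0, 0, -1;
       ε * ν 2, 0, 0, 0, 1, 0;
       0, 0, 0, ε * ν 0, 0, 0;
       0, 0, 1, ε * ν 1, 0, 0;
       0, -1, 0, ε * ν 2, 0, 0],
    !![0, ε * ν 0, 0, 0, 0, 1;
       0, ε * ν 1, 0, 0, 0, 0;
       0, ε * ν 2, 0, -1, 0, 0;
       0, 0, -1, 0, ε * ν 0, 0;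
       0, 0, 0, 0, ε * ν 1, 0;
       1, 0, 0, 0, ε * ν 2, 0],
    !![0, 0, ε * ν 0, 0, -1, 0;
       0, 0, ε * ν 1, 1, 0, 0;
       0, 0, ε * ν 2, 0, 0, 0;
       0, 1, 0, 0, 0, ε * ν 0;
       -1, 0, 0, 0, 0, ε * ν 1;
       0, 0, 0, 0, 0, ε * ν 2]]

/-- `A₁⁻(ν), A₂⁻(ν)` for `d = 2`. -/
def Aminus2 (ε : ℝ) (ν : Fin 2 → ℝ) : Fin 2 → Matrix (Fin 3) (Fin 3) ℝ :=
  ![!![ε * ν 0, 0, 0;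
       ε * ν 1, 0, -1;
       0, -1, 0],
    !![0, ε * ν 0, 1;
       0, ε * ν 1, 0;
       1, 0, 0]]

/-- Vacuum magnetic field `h`, `d = 3`. -/
def h3 (u : Fin 6 → ℝ) : Fin 3 → ℝ := ![u 0, u 1, u 2]

/-- Vacuum electric field `e`, `d = 3`. -/
def e3 (u : Fin 6 → ℝ) : Fin 3 → ℝ := ![u 3, u 4, u 5]

/-- Vacuum magnetic field `h`, `d = 2`. -/
def h2 (u : Fin 3 → ℝ) : Fin 2 → ℝ := ![u 0, u 1]

/-- Vacuum electric field `e` (a scalar), `d = 2`. -/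
def e2 (u : Fin 3 → ℝ) : ℝ := u 2

/-- The boundary operator for `d = 3`, as a function of the traces of `U` and `u`, of
`φₜ = ∂ₜφ` and of `φ' = (∂₂φ, ∂₃φ)`. -/
def bdryOp3 (ε : ℝ) (U : PIdx 3 → ℝ) (u : Fin 6 → ℝ) (φt : ℝ) (φ' : Fin 2 → ℝ) : Fin 4 → ℝ :=
  ![φt - vC U 0 + vC U 1 * φ' 0 + vC U 2 * φ' 1,
    qC U - 1 / 2 * (h3 u ⬝ᵥ h3 u) + 1 / 2 * (e3 u ⬝ᵥ e3 u),
    e3 u 1 + φ' 0 * e3 u 0 - ε * φt * h3 u 2,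
    e3 u 2 + φ' 1 * e3 u 0 + ε * φt * h3 u 1]

/-- The boundary operator for `d = 2`, as a function of the traces of `U` and `u`, of
`φₜ = ∂ₜφ` and of `φ' = ∂₂φ`. -/
def bdryOp2 (ε : ℝ) (U : PIdx 2 → ℝ) (u : Fin 3 → ℝ) (φt : ℝ) (φ' : Fin 1 → ℝ) : Fin 3 → ℝ :=
  ![φt - vC U 0 + vC U 1 * φ' 0,
    qC U - 1 / 2 * (h2 u ⬝ᵥ h2 u) + 1 / 2 * e2 u ^ 2,
    e2 u + ε * φt * h2 u 1]

/-! ### Solutions of the reformulated problem in the fixed domain -/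

/-- `(U, u, φ)`, with the extended velocity `ν`, is a solution, of class `C²` up to the boundary
(`C¹` for `ν`), of the problem in the fixed domain on `[0,T]`, with initial data `(U₀, u₀, φ₀)`,
in the physical range of the variables.  The family `Am ν` is `A₁⁻(ν), …, A_d⁻(ν)` and `B` is the
boundary operator. -/
structure IsSolution {n m l : ℕ} (ε T : ℝ) (c : Constitutive) (χ : ℝ → ℝ)
    (Am : (Fin (n + 1) → ℝ) → Fin (n + 1) → Matrix (Fin m) (Fin m) ℝ)
    (B : (PIdx (n + 1) → ℝ) → (Fin m → ℝ) → ℝ → (Fin n → ℝ) → Fin l → ℝ)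
    (U : ℝ × (Fin (n + 1) → ℝ) → PIdx (n + 1) → ℝ)
    (u : ℝ × (Fin (n + 1) → ℝ) → Fin m → ℝ)
    (φ : ℝ × (Fin n → ℝ) → ℝ)
    (ν : ℝ × (Fin (n + 1) → ℝ) → Fin (n + 1) → ℝ)
    (U₀ : (Fin (n + 1) → ℝ) → PIdx (n + 1) → ℝ) (u₀ : (Fin (n + 1) → ℝ) → Fin m → ℝ)
    (φ₀ : (Fin n → ℝ) → ℝ) : Prop where
  smooth_U : ContDiffOn ℝ 2 U (slab n T)
  smooth_u : ContDiffOn ℝ 2 u (slab n T)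
  smooth_φ : ContDiffOn ℝ 2 φ (bdrySlab n T)
  smooth_ν : ContDiffOn ℝ 1 ν (slab n T)
  /-- `‖φ‖_∞ ≤ 2` on `[0,T] × ℝⁿ`, so that the change of variables is admissible -/
  φ_le : ∀ z ∈ bdrySlab n T, |φ z| ≤ 2
  /-- `ν = v` on the boundary -/
  ν_bdry : ∀ t ∈ Icc 0 T, ∀ x', ν (t, bdryPt x') = vC (U (t, bdryPt x'))
  /-- `|ν| < ε⁻¹` -/
  ν_lt : ∀ t ∈ Icc 0 T, ∀ x ∈ halfSpace n, eucl (ν (t, x)) < ε⁻¹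
  /-- `|v| < ε⁻¹` -/
  v_lt : ∀ t ∈ Icc 0 T, ∀ x ∈ halfSpace n, eucl (vC (U (t, x))) < ε⁻¹
  /-- `ρ_* < ρ < ρ^*` -/
  hyperbolic : ∀ t ∈ Icc 0 T, ∀ x ∈ halfSpace n, c.Hyperbolic (thermo ε (U (t, x)))
  /-- `L₊(U, Φ⁺) U = 0` -/
  plasma : ∀ t ∈ Icc 0 T, ∀ x ∈ halfSpace n,
    opL (slab n T) 1 (fun z => Aplus ε (U z) c) (lift χ φ 1) U (t, x) = 0
  /-- `L₋(ν, Φ⁻) u = 0` -/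
  vacuum : ∀ t ∈ Icc 0 T, ∀ x ∈ halfSpace n,
    opL (slab n T) ε (fun z => Am (ν z)) (lift χ φ (-1)) u (t, x) = 0
  /-- `𝔹(U, u, φ) = 0` on the boundary -/
  boundary : ∀ t ∈ Icc 0 T, ∀ x',
    B (U (t, bdryPt x')) (u (t, bdryPt x')) (dt (bdrySlab n T) φ (t, x'))
      (fun j => dx (bdrySlab n T) j φ (t, x')) = 0
  init_U : ∀ x ∈ closedHalfSpace n, U (0, x) = U₀ x
  init_u : ∀ x ∈ closedHalfSpace n, u (0, x) = u₀ x
  init_φ : ∀ x', φ (0, x') = φ₀ x'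

/-- The equation `∇^Φ · F = 0` in `Ω` at time `t`. -/
def DivFreeAt {n : ℕ} (T : ℝ) (Φ : ℝ × (Fin (n + 1) → ℝ) → ℝ)
    (F : ℝ × (Fin (n + 1) → ℝ) → Fin (n + 1) → ℝ) (t : ℝ) : Prop :=
  ∀ x ∈ halfSpace n, divLift (slab n T) Φ F (t, x) = 0

/-- The equation `F · N = 0` on `Σ` at time `t`. -/
def TangentAt {n : ℕ} (T : ℝ) (φ : ℝ × (Fin n → ℝ) → ℝ)
    (F : ℝ × (Fin (n + 1) → ℝ) → Fin (n + 1) → ℝ) (t : ℝ) : Prop :=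
  ∀ x', F (t, bdryPt x') ⬝ᵥ normalN T φ (t, x') = 0

/-- If `P` holds initially, then it holds at all times of `[0,T]`. -/
def Preserved (T : ℝ) (P : ℝ → Prop) : Prop := P 0 → ∀ t ∈ Icc 0 T, P t

end PlasmaVacuum

end

/-! The operators `∂ₜ^Φ`, `∂ᵢ^Φ` are the coordinate derivatives of the moving domain, pulled back by
`(t, Φ, x')`; in particular they commute. Each constrained field `F` (`H` with velocity `ν = v`, and
`h`, `e` with the extended velocity `ν`) satisfies an equation of one shape, `∂ₜ^Φ F + ∇^Φ·Ψ +
(∇^Φ·F) ν = 0` with `Ψ` antisymmetric: `v ⊗ H - H ⊗ v` for the plasma, the matrix of a cross product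
(a rotation by 90° if `d = 2`) for the vacuum.

Taking the divergence kills `Ψ`, so `D = ∇^Φ·F` solves `∂ₜ^Φ D + ∇^Φ·(D ν) = 0`
(`transport_divergence`). Because `ν·N = ∂ₜφ` on `Σ`, the characteristics are tangent to the
boundary, and no boundary value of `D` is needed.

On `Σ`, dotting the same equation with `N` removes all normal derivatives: those of `Ψ` by
antisymmetry, those of `F` by `ν·N = ∂ₜφ`. The tangential rows of `Ψ N` are known from the boundary
conditions, `(Ψ N)ⱼ = βⱼ (F·N) - Fⱼ ∂ₜφ`, so that `G = F·N` solves `∂ₜG + ∇'·(β G) = 0`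
(`transport_normal`). Here `β` is the tangential velocity for `H` and `β = 0` for `h`. Neither
argument uses the other constraint, so each constraint propagates separately.

Both linear transport problems have only the zero solution for zero data (`eq_zero_of_transport`).
This is proved by a weighted maximum argument, without constructing a flow; the speed bound `ε⁻¹` in
the coordinates `(Φ, x')` replaces any decay at infinity.

The induction equation for `H` has to be extracted from `Aⱼ⁺ = J⁻¹ B₀⁻¹ Bⱼ J`. This needs `J` and
`B₀` to be invertible (`isUnit_det_B0` uses that sound is slower than light) and the identity
`Nj_mulVec`, which exhibits `𝓜₀` as a common factor of the `H` rows (`induction_of_plasma`). -/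

noncomputable section

namespace PlasmaVacuum

/-! ### Commuting lifted derivatives and the equation for a divergence -/

section LiftedDerivative

variable {E : Type*} [NormedAddCommGroup E] [NormedSpace ℝ E] {S : Set E} {f g : E → ℝ} {z : E}

/-- The derivative of `f` along the field `a + λ e` that differentiates `g` to the constant `κ`. -/
def pd (S : Set E) (g : E → ℝ) (e a : E) (κ : ℝ) (f : E → ℝ) (z : E) : ℝ :=
  fderivWithin ℝ f S z a
    + (κ - fderivWithin ℝ g S z a) / fderivWithin ℝ g S z e * fderivWithin ℝ f S z e

/-- At a fixed point the lifted derivative is one directional derivative, so linearity and the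
Leibniz rule are inherited from `fderivWithin`. -/
theorem pd_eq (e a : E) (κ : ℝ) :
    pd S g e a κ f z = fderivWithin ℝ f S z
      (a + ((κ - fderivWithin ℝ g S z a) / fderivWithin ℝ g S z e) • e) := by
  simp [pd]

theorem pd_congr {f₁ f₂ : E → ℝ} (h : EqOn f₁ f₂ S) (hz : z ∈ S) (e a : E) (κ : ℝ) :
    pd S g e a κ f₁ z = pd S g e a κ f₂ z := by
  simp only [pd, fderivWithin_congr h (h hz)]

theorem pd_zero (e a : E) (κ : ℝ) : pd S g e a κ (fun _ => 0) z = 0 := by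
  simp [pd]

theorem pd_add (hS : UniqueDiffOn ℝ S) (hz : z ∈ S) {f₁ f₂ : E → ℝ}
    (h₁ : DifferentiableWithinAt ℝ f₁ S z) (h₂ : DifferentiableWithinAt ℝ f₂ S z) (e a : E) (κ : ℝ) :
    pd S g e a κ (fun y => f₁ y + f₂ y) z = pd S g e a κ f₁ z + pd S g e a κ f₂ z := by
  simp only [pd_eq]
  rw [fderivWithin_fun_add (hS z hz) h₁ h₂]; rfl

theorem pd_mul (hS : UniqueDiffOn ℝ S) (hz : z ∈ S) {f₁ f₂ : E → ℝ}
    (h₁ : DifferentiableWithinAt ℝ f₁ S z) (h₂ : DifferentiableWithinAt ℝ f₂ S z) (e a : E) (κ : ℝ) :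
    pd S g e a κ (fun y => f₁ y * f₂ y) z
      = f₁ z * pd S g e a κ f₂ z + pd S g e a κ f₁ z * f₂ z := by
  simp only [pd_eq]
  rw [fderivWithin_fun_mul (hS z hz) h₁ h₂]
  simp [mul_comm]

theorem pd_neg (hS : UniqueDiffOn ℝ S) (hz : z ∈ S) (e a : E) (κ : ℝ) :
    pd S g e a κ (fun y => -f y) z = -pd S g e a κ f z := by
  simp only [pd_eq]
  rw [fderivWithin_fun_neg (hS z hz)]; rfl

theorem pd_sum (hS : UniqueDiffOn ℝ S) (hz : z ∈ S) {ι : Type*} [Fintype ι] {f : ι → E → ℝ}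
    (h : ∀ i, DifferentiableWithinAt ℝ (f i) S z) (e a : E) (κ : ℝ) :
    pd S g e a κ (fun y => ∑ i, f i y) z = ∑ i, pd S g e a κ (f i) z := by
  simp only [pd_eq]
  rw [fderivWithin_fun_sum (hS z hz) (fun i _ => h i)]
  simp

theorem contDiffOn_fderivWithin_apply (hS : UniqueDiffOn ℝ S) (hf : ContDiffOn ℝ 2 f S) (a : E) :
    ContDiffOn ℝ 1 (fun y => fderivWithin ℝ f S y a) S :=
  (hf.fderivWithin hS (by norm_num)).clm_apply contDiffOn_const

/-- Schwarz's theorem up to the boundary. Symmetry of the second derivative within `S` requires the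
point to be a limit of interior points, hence `hcl`. -/
theorem fderivWithin_apply_comm (hS : UniqueDiffOn ℝ S) (hcl : S ⊆ closure (interior S))
    (hf : ContDiffOn ℝ 2 f S) (hz : z ∈ S) (a b : E) :
    fderivWithin ℝ (fun y => fderivWithin ℝ f S y a) S z b
      = fderivWithin ℝ (fun y => fderivWithin ℝ f S y b) S z a := by
  have hd : DifferentiableWithinAt ℝ (fderivWithin ℝ f S) S z :=
    (hf.fderivWithin hS (m := 1) (by norm_num)).differentiableOn (by norm_num) z hz
  have key : ∀ a b : E, fderivWithin ℝ (fun y => fderivWithin ℝ f S y a) S z b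
      = fderivWithin ℝ (fderivWithin ℝ f S) S z b a := by
    intro a b
    rw [fderivWithin_clm_apply (hS z hz) hd (differentiableWithinAt_const a)]
    simp
  rw [key, key]
  exact ((hf z hz).isSymmSndFDerivWithinAt (by simp) hS (hcl hz) hz) b a

theorem contDiffOn_pd (hS : UniqueDiffOn ℝ S) (hf : ContDiffOn ℝ 2 f S) (hg : ContDiffOn ℝ 2 g S)
    {e : E} (hne : ∀ y ∈ S, fderivWithin ℝ g S y e ≠ 0) (a : E) (κ : ℝ) :
    ContDiffOn ℝ 1 (pd S g e a κ f) S :=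
  (contDiffOn_fderivWithin_apply hS hf a).add
    (((contDiffOn_const.sub (contDiffOn_fderivWithin_apply hS hg a)).div
      (contDiffOn_fderivWithin_apply hS hg e) hne).mul (contDiffOn_fderivWithin_apply hS hf e))

theorem continuousOn_pd (hS : UniqueDiffOn ℝ S) (hf : ContDiffOn ℝ 1 f S) (hg : ContDiffOn ℝ 2 g S)
    {e : E} (hne : ∀ y ∈ S, fderivWithin ℝ g S y e ≠ 0) (a : E) (κ : ℝ) :
    ContinuousOn (pd S g e a κ f) S := by
  have h : ∀ a : E, ContinuousOn (fun y => fderivWithin ℝ f S y a) S := fun a =>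
    (hf.continuousOn_fderivWithin hS (by norm_num)).clm_apply continuousOn_const
  have h' : ∀ a : E, ContinuousOn (fun y => fderivWithin ℝ g S y a) S := fun a =>
    (contDiffOn_fderivWithin_apply hS hg a).continuousOn
  exact (h a).add (((continuousOn_const.sub (h' a)).div (h' e) hne).mul (h e))

/-- The lifted derivatives commute. -/
theorem pd_comm (hS : UniqueDiffOn ℝ S) (hcl : S ⊆ closure (interior S))
    (hf : ContDiffOn ℝ 2 f S) (hg : ContDiffOn ℝ 2 g S)
    {e : E} (hne : ∀ y ∈ S, fderivWithin ℝ g S y e ≠ 0) (hz : z ∈ S) (a b : E) (κ μ : ℝ) :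
    pd S g e a κ (pd S g e b μ f) z = pd S g e b μ (pd S g e a κ f) z := by
  have df : ∀ a : E, DifferentiableWithinAt ℝ (fun y => fderivWithin ℝ f S y a) S z := fun a =>
    (contDiffOn_fderivWithin_apply hS hf a).differentiableOn (by norm_num) z hz
  have dg : ∀ a : E, DifferentiableWithinAt ℝ (fun y => fderivWithin ℝ g S y a) S z := fun a =>
    (contDiffOn_fderivWithin_apply hS hg a).differentiableOn (by norm_num) z hz
  set c : E → ℝ → E → ℝ := fun a κ y =>
    (κ - fderivWithin ℝ g S y a) / fderivWithin ℝ g S y e with hc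
  have dc : ∀ a κ, DifferentiableWithinAt ℝ (c a κ) S z := fun a κ => by
    simp only [hc, div_eq_mul_inv]
    exact ((differentiableWithinAt_const κ).fun_sub (dg a)).fun_mul ((dg e).inv (hne z hz))
  -- The derivative of the relation `c · ∂ₑg = κ - ∂ₐg`, which says that `a + c e` differentiates
  -- `g` to the constant `κ`.
  have hcg : ∀ a κ x, fderivWithin ℝ (c a κ) S z x * fderivWithin ℝ g S z e
      = -fderivWithin ℝ (fun y => fderivWithin ℝ g S y a) S z x
        - c a κ z * fderivWithin ℝ (fun y => fderivWithin ℝ g S y e) S z x := by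
    intro a κ x
    have heq : EqOn (fun y => c a κ y * fderivWithin ℝ g S y e)
        (fun y => κ - fderivWithin ℝ g S y a) S := fun y hy => by
      simp only [hc]; exact div_mul_cancel₀ _ (hne y hy)
    have h := congrArg (fun l : E →L[ℝ] ℝ => l x) (fderivWithin_congr (𝕜 := ℝ) heq (heq hz))
    simp only [fderivWithin_fun_mul (hS z hz) (dc a κ) (dg e),
      fderivWithin_const_sub (hS z hz) κ] at h
    simp at h
    linarith
  have hexp : ∀ a b κ μ, pd S g e a κ (pd S g e b μ f) z
      = fderivWithin ℝ (fun y => fderivWithin ℝ f S y b) S z a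
        + c b μ z * fderivWithin ℝ (fun y => fderivWithin ℝ f S y e) S z a
        + fderivWithin ℝ (c b μ) S z a * fderivWithin ℝ f S z e
        + c a κ z * (fderivWithin ℝ (fun y => fderivWithin ℝ f S y b) S z e
        + c b μ z * fderivWithin ℝ (fun y => fderivWithin ℝ f S y e) S z e
        + fderivWithin ℝ (c b μ) S z e * fderivWithin ℝ f S z e) := by
    intro a b κ μ
    have h : fderivWithin ℝ (pd S g e b μ f) S z = _ :=
      ((df b).hasFDerivWithinAt.add
        ((dc b μ).hasFDerivWithinAt.mul (df e).hasFDerivWithinAt)).fderivWithin (hS z hz)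
    rw [pd, h]
    simp only [hc, add_apply, smul_apply, smul_eq_mul]
    ring
  have sf := fderivWithin_apply_comm hS hcl hf hz
  have sg := fderivWithin_apply_comm hS hcl hg hz
  rw [hexp, hexp, sf b a, sf e a, sf b e]
  -- As `a`, `b`, `e` are constant, the bracket of the two fields is a multiple of `e`. It also
  -- annihilates `g`, since both fields take `g` to constants. As `∂ₑg ≠ 0`, its coefficient
  -- vanishes, which is this identity.
  have key : fderivWithin ℝ (c b μ) S z a + c a κ z * fderivWithin ℝ (c b μ) S z e
      = fderivWithin ℝ (c a κ) S z b + c b μ z * fderivWithin ℝ (c a κ) S z e := by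
    apply mul_right_cancel₀ (hne z hz)
    have h1 := hcg b μ a
    have h2 := hcg b μ e
    have h3 := hcg a κ b
    have h4 := hcg a κ e
    rw [sg b a, sg e a] at h1
    rw [sg b e] at h2
    linear_combination h1 + c a κ z * h2 - h3 - c b μ z * h4
  linear_combination fderivWithin ℝ f S z e * key

/-- If `∂ₜF + ∇·Ψ + (∇·F) ν = 0` with `Ψ` antisymmetric, then `∇·F` is transported by `ν`. -/
theorem transport_divergence (hS : UniqueDiffOn ℝ S) (hcl : S ⊆ closure (interior S))
    (hg : ContDiffOn ℝ 2 g S) {e : E} (hne : ∀ y ∈ S, fderivWithin ℝ g S y e ≠ 0)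
    {ι : Type*} [Fintype ι] (a₀ : E) (a : ι → E) (κ₀ : ℝ) (κ : ι → ℝ)
    {F ν : ι → E → ℝ} {Ψ : ι → ι → E → ℝ} (hF : ∀ i, ContDiffOn ℝ 2 (F i) S)
    (hΨ : ∀ i j, ContDiffOn ℝ 2 (Ψ i j) S) (hν : ∀ i, ContDiffOn ℝ 1 (ν i) S)
    (hanti : ∀ i j z, Ψ i j z = -Ψ j i z)
    (heq : ∀ z ∈ S, ∀ i, pd S g e a₀ κ₀ (F i) z + ∑ j, pd S g e (a j) (κ j) (Ψ j i) z
      + (∑ j, pd S g e (a j) (κ j) (F j) z) * ν i z = 0)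
    (hz : z ∈ S) :
    pd S g e a₀ κ₀ (fun y => ∑ j, pd S g e (a j) (κ j) (F j) y) z
      + ∑ i, ν i z * pd S g e (a i) (κ i) (fun y => ∑ j, pd S g e (a j) (κ j) (F j) y) z
      + (∑ j, pd S g e (a j) (κ j) (F j) z) * ∑ i, pd S g e (a i) (κ i) (ν i) z = 0 := by
  have dpd : ∀ {f : E → ℝ}, ContDiffOn ℝ 2 f S → ∀ a κ,
      DifferentiableWithinAt ℝ (pd S g e a κ f) S z := fun hf a κ =>
    (contDiffOn_pd hS hf hg hne a κ).differentiableOn (by norm_num) z hz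
  set D : E → ℝ := fun y => ∑ j, pd S g e (a j) (κ j) (F j) y with hD
  have dD : DifferentiableWithinAt ℝ D S z :=
    DifferentiableWithinAt.fun_sum fun j _ => dpd (hF j) _ _
  have dν : ∀ i, DifferentiableWithinAt ℝ (ν i) S z := fun i =>
    (hν i).differentiableOn (by norm_num) z hz
  -- The `i`-th equation differentiated in the `i`-th lifted direction; it holds on all of `S`, so
  -- derivatives within `S` may be compared.
  have h1 : ∀ i, pd S g e (a i) (κ i) (pd S g e a₀ κ₀ (F i)) z
      + ∑ j, pd S g e (a i) (κ i) (pd S g e (a j) (κ j) (Ψ j i)) z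
      + (D z * pd S g e (a i) (κ i) (ν i) z + pd S g e (a i) (κ i) D z * ν i z) = 0 := by
    intro i
    have h := pd_congr (g := g) (f₁ := fun z => (pd S g e a₀ κ₀ (F i) z
      + ∑ j, pd S g e (a j) (κ j) (Ψ j i) z) + D z * ν i z) (f₂ := fun _ => 0)
      (fun y hy => heq y hy i) hz e (a i) (κ i)
    rw [pd_zero, pd_add hS hz ((dpd (hF i) _ _).fun_add
      (DifferentiableWithinAt.fun_sum fun j _ => dpd (hΨ j i) _ _)) (dD.fun_mul (dν i)),
      pd_add hS hz (dpd (hF i) _ _) (DifferentiableWithinAt.fun_sum fun j _ => dpd (hΨ j i) _ _),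
      pd_sum hS hz (fun j => dpd (hΨ j i) _ _), pd_mul hS hz dD (dν i)] at h
    exact h
  have h2 := Finset.sum_eq_zero (s := Finset.univ) fun i _ => h1 i
  simp only [Finset.sum_add_distrib] at h2
  -- The double divergence equals its own negative: exchange the indices, commute the derivatives
  -- and use antisymmetry.
  have h3 : ∑ i, ∑ j, pd S g e (a i) (κ i) (pd S g e (a j) (κ j) (Ψ j i)) z = 0 := by
    have : ∑ i, ∑ j, pd S g e (a i) (κ i) (pd S g e (a j) (κ j) (Ψ j i)) z
        = -∑ i, ∑ j, pd S g e (a i) (κ i) (pd S g e (a j) (κ j) (Ψ j i)) z := by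
      conv_lhs => rw [Finset.sum_comm]
      rw [← Finset.sum_neg_distrib]
      refine Finset.sum_congr rfl fun j _ => ?_
      rw [← Finset.sum_neg_distrib]
      refine Finset.sum_congr rfl fun i _ => ?_
      rw [pd_comm hS hcl (hΨ j i) hg hne hz, ← pd_neg hS hz]
      refine pd_congr (fun y hy => ?_) hz _ _ _
      rw [← pd_neg hS hy]
      exact pd_congr (fun x _ => hanti j i x) hy _ _ _
    linarith
  rw [hD, pd_sum hS hz (fun j => dpd (hF j) _ _)]
  rw [h3, Finset.sum_congr rfl fun i _ => pd_comm hS hcl (hF i) hg hne hz (a i) a₀ (κ i) κ₀,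
    ← Finset.mul_sum] at h2
  simp only [mul_comm (ν _ z)]
  linarith

end LiftedDerivative

/-! ### Uniqueness for linear transport by a maximum argument -/

section Transport

variable {E : Type*} [NormedAddCommGroup E] [NormedSpace ℝ E] {S : Set E}

/-- Uniqueness for a linear transport equation whose characteristics do not leave the convex set
`S` backwards in time and have bounded speed in the coordinates `y`. -/
theorem eq_zero_of_transport (hS : UniqueDiffOn ℝ S) (hconv : Convex ℝ S) (τ : E →L[ℝ] ℝ)
    (hτ : ∀ z ∈ S, 0 ≤ τ z) {f b : E → ℝ} {w : E → E} {ι : Type*} [Fintype ι] {y : ι → E → ℝ}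
    {M : ℝ} (hM : 0 ≤ M) (hf : DifferentiableOn ℝ f S) (hb : ContinuousOn b S)
    (hy : ∀ i, DifferentiableOn ℝ (y i) S)
    (hK : ∀ R, IsCompact {z ∈ S | ∀ i, |y i z| ≤ R})
    (hw : ∀ z ∈ S, τ (w z) = 1)
    (hyw : ∀ z ∈ S, ∀ i, |fderivWithin ℝ (y i) S z (w z)| ≤ M)
    (hback : ∀ z ∈ S, 0 < τ z → ∃ δ > (0 : ℝ), z - δ • w z ∈ S)
    (heq : ∀ z ∈ S, fderivWithin ℝ f S z (w z) = b z * f z)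
    (hinit : ∀ z ∈ S, τ z = 0 → f z = 0) :
    ∀ z ∈ S, f z = 0 := by
  by_contra! hcon
  obtain ⟨z₀, hz₀, hfz₀⟩ := hcon
  -- From `2|yᵢ| ≤ 1 + yᵢ²` and the speed bound, `Q` changes along `w` at a rate of at most `Λ Q`.
  -- Hence `exp(Λτ) Q` does not decrease along `w`, and `ψ` does not increase. The choice of `R`
  -- gives `ψ z₀ = 1`, and `{ψ ≥ 0}` is compact because it bounds every `yᵢ`.
  set Λ : ℝ := M * (Fintype.card ι + 1) with hΛ
  have hΛ0 : 0 ≤ Λ := by positivity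
  set Q : E → ℝ := fun z => 1 + ∑ i, y i z ^ 2 with hQ
  have hQ0 : ∀ z, 1 ≤ Q z := fun z => by
    have : 0 ≤ ∑ i, y i z ^ 2 := Finset.sum_nonneg fun i _ => sq_nonneg _
    simp only [hQ]; linarith
  set R : ℝ := Real.exp (Λ * τ z₀) * Q z₀ + 1 with hR
  set ψ : E → ℝ := fun z => R - Real.exp (Λ * τ z) * Q z with hψ
  have hcy : ∀ i, ContinuousOn (y i) S := fun i => (hy i).continuousOn
  have hcQ : ContinuousOn Q S :=
    continuousOn_const.add (continuousOn_finsetSum _ fun i _ => (hcy i).pow 2)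
  have hcψ : ContinuousOn ψ S := continuousOn_const.sub
    ((Real.continuous_exp.comp (continuous_const.mul τ.continuous)).continuousOn.mul hcQ)
  have hsub : {z ∈ S | 0 ≤ ψ z} ⊆ {z ∈ S | ∀ i, |y i z| ≤ R} := by
    rintro z ⟨hz, hzψ⟩
    refine ⟨hz, fun i => ?_⟩
    have h1 : 1 ≤ Real.exp (Λ * τ z) := Real.one_le_exp (mul_nonneg hΛ0 (hτ z hz))
    have h2 : Q z ≤ R := by
      have : Q z ≤ Real.exp (Λ * τ z) * Q z := le_mul_of_one_le_left (by linarith [hQ0 z]) h1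
      simp only [hψ] at hzψ; linarith
    have h3 : y i z ^ 2 ≤ ∑ i, y i z ^ 2 :=
      Finset.single_le_sum (f := fun i => y i z ^ 2) (fun i _ => sq_nonneg _) (Finset.mem_univ i)
    simp only [hQ] at h2
    have h4 : |y i z| ^ 2 ≤ R - 1 := by rw [sq_abs]; linarith
    nlinarith [sq_nonneg (|y i z| - 1 / 2)]
  have hcomp : IsCompact {z ∈ S | 0 ≤ ψ z} := by
    have : {z ∈ S | 0 ≤ ψ z} = {z ∈ S | ∀ i, |y i z| ≤ R} ∩ {z ∈ S | 0 ≤ ψ z} :=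
      (inter_eq_right.2 hsub).symm
    rw [this]
    have hc := (hcψ.mono (fun z (hz : z ∈ {z ∈ S | ∀ i, |y i z| ≤ R}) => hz.1))
    have h := hc.preimage_isClosed_of_isClosed (hK R).isClosed isClosed_Ici (t := Ici 0)
    convert (hK R).of_isClosed_subset h inter_subset_left using 1
    ext z
    simp only [mem_inter_iff, mem_ofPred_eq, mem_preimage, mem_Ici]
    tauto
  obtain ⟨B, hB⟩ := hcomp.exists_bound_of_continuousOn (hb.mono fun z hz => hz.1)
  -- Large enough for `exp(-lτ) f²` to decrease strictly along `w` wherever `f ≠ 0` and `|b| ≤ B`,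
  -- its logarithmic derivative being `2b - l ≤ -1`.
  set l : ℝ := 2 * B + 1 with hl
  set G : E → ℝ := fun z => ψ z * (Real.exp (-l * τ z) * f z ^ 2) with hG
  have hcG : ContinuousOn G S := hcψ.mul
    ((Real.continuous_exp.comp (continuous_const.mul τ.continuous)).continuousOn.mul
      (hf.continuousOn.pow 2))
  have hψ0 : ψ z₀ = 1 := by simp [hψ, hR]
  obtain ⟨z₁, ⟨hz₁, hψ₁⟩, hmax⟩ := hcomp.exists_isMaxOn ⟨z₀, hz₀, by simp [hψ0]⟩
    (hcG.mono fun z hz => hz.1)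
  have hGz₀ : 0 < G z₀ := by
    simp only [hG, hψ0]; positivity
  have hGz₁ : 0 < G z₁ := hGz₀.trans_le (hmax ⟨hz₀, by simp [hψ0]⟩)
  -- Outside `{ψ ≥ 0}` the function `G` is nonpositive, so the maximum on the compact set is one on
  -- all of `S`.
  have hmaxS : IsMaxOn G S z₁ := by
    intro z hz
    by_cases h : 0 ≤ ψ z
    · exact hmax ⟨hz, h⟩
    · refine (le_trans ?_ hGz₁.le : G z ≤ G z₁)
      exact mul_nonpos_of_nonpos_of_nonneg (not_le.1 h).le (by positivity)
  have hfz₁ : f z₁ ≠ 0 := by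
    intro h; simp [hG, h] at hGz₁
  have hψpos : 0 < ψ z₁ := by
    refine lt_of_le_of_ne hψ₁ fun h => ?_
    simp [hG, ← h] at hGz₁
  have hτ₁ : 0 < τ z₁ := lt_of_le_of_ne (hτ z₁ hz₁) fun h => hfz₁ (hinit z₁ hz₁ h.symm)
  obtain ⟨δ, hδ, hδS⟩ := hback z₁ hz₁ hτ₁
  -- By convexity the whole backward segment lies in `S`. Maximality at `z₁` therefore forces `∂_w G
  -- ≥ 0`, even when `z₁` is on the boundary of `S`; the rest shows `∂_w G < 0`.
  have hcone : -(δ • w z₁) ∈ posTangentConeAt S z₁ := by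
    apply mem_posTangentConeAt_of_segment_subset
    rw [← sub_eq_add_neg]
    exact hconv.segment_subset hz₁ hδS
  have hle := hmaxS.localize.fderivWithin_nonpos hcone
  rw [map_neg, map_smul, smul_eq_mul, neg_nonpos] at hle
  have hGw : 0 ≤ fderivWithin ℝ G S z₁ (w z₁) := nonneg_of_mul_nonneg_right hle hδ
  have dτ : HasFDerivWithinAt τ τ S z₁ := τ.hasFDerivWithinAt
  have df := (hf z₁ hz₁).hasFDerivWithinAt
  have dQ : HasFDerivWithinAt Q (∑ i, (2 * y i z₁) • fderivWithin ℝ (y i) S z₁) S z₁ := by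
    have := (HasFDerivWithinAt.fun_sum (u := Finset.univ) fun i (_ : i ∈ Finset.univ) =>
      ((hy i) z₁ hz₁).hasFDerivWithinAt.pow 2).const_add 1
    refine this.congr_fderiv (Finset.sum_congr rfl fun i _ => ?_)
    ext x
    simp
  have dψ := ((dτ.const_mul Λ).exp.mul dQ).const_sub R
  have dG := dψ.mul ((dτ.const_mul (-l)).exp.mul (df.pow 2))
  have hval : fderivWithin ℝ G S z₁ (w z₁) = _ :=
    congrArg (fun L : E →L[ℝ] ℝ => L (w z₁)) (dG.fderivWithin (hS z₁ hz₁))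
  have hQw : -(Λ * Q z₁) ≤ ∑ i, 2 * y i z₁ * fderivWithin ℝ (y i) S z₁ (w z₁) := by
    have h1 : ∀ i, -(M * (1 + y i z₁ ^ 2)) ≤ 2 * y i z₁ * fderivWithin ℝ (y i) S z₁ (w z₁) := by
      intro i
      have h := abs_le.1 (hyw z₁ hz₁ i)
      have h2 : |2 * y i z₁| ≤ 1 + y i z₁ ^ 2 := by
        rw [abs_le]; constructor <;> nlinarith [sq_nonneg (y i z₁ - 1), sq_nonneg (y i z₁ + 1)]
      have h3 : |2 * y i z₁ * fderivWithin ℝ (y i) S z₁ (w z₁)| ≤ (1 + y i z₁ ^ 2) * M := by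
        rw [abs_mul]; exact mul_le_mul h2 (hyw z₁ hz₁ i) (abs_nonneg _) (by positivity)
      linarith [neg_abs_le (2 * y i z₁ * fderivWithin ℝ (y i) S z₁ (w z₁))]
    have h2 := Finset.sum_le_sum fun i (_ : i ∈ Finset.univ) => h1 i
    rw [Finset.sum_neg_distrib, ← Finset.mul_sum, Finset.sum_add_distrib] at h2
    simp only [Finset.sum_const, Finset.card_univ, nsmul_eq_mul, mul_one] at h2
    refine le_trans (neg_le_neg ?_) h2
    simp only [hΛ, hQ]
    have h0 : 0 ≤ ∑ i, y i z₁ ^ 2 := Finset.sum_nonneg fun i _ => sq_nonneg _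
    have : 0 ≤ M * (1 + (Fintype.card ι : ℝ) * ∑ i, y i z₁ ^ 2) := by positivity
    linarith
  have hbB : |b z₁| ≤ B := hB z₁ ⟨hz₁, hψ₁⟩
  set A := Real.exp (Λ * τ z₁)
  set C := Real.exp (-l * τ z₁)
  have hval' : fderivWithin ℝ G S z₁ (w z₁)
      = C * (ψ z₁ * f z₁ ^ 2 * (2 * b z₁ - l)
        - A * f z₁ ^ 2 * (Λ * Q z₁ + ∑ i, 2 * y i z₁ * fderivWithin ℝ (y i) S z₁ (w z₁))) := by
    rw [hval]
    simp [hw z₁ hz₁, heq z₁ hz₁]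
    simp only [hψ, A, C, neg_mul]
    ring
  have h1 : 0 ≤ A * f z₁ ^ 2 * (Λ * Q z₁ + ∑ i, 2 * y i z₁ * fderivWithin ℝ (y i) S z₁ (w z₁)) :=
    mul_nonneg (by positivity) (by linarith)
  have h2 : ψ z₁ * f z₁ ^ 2 * (2 * b z₁ - l) < 0 :=
    mul_neg_of_pos_of_neg (by positivity) (by linarith [le_abs_self (b z₁)])
  have h3 : fderivWithin ℝ G S z₁ (w z₁) < 0 := by
    rw [hval']; exact mul_neg_of_pos_of_neg (Real.exp_pos _) (by linarith)
  linarith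

end Transport

/-! ### The space-time domains -/

section Domains

variable {n : ℕ} {T : ℝ}

theorem closedHalfSpace_subset_closure : closedHalfSpace n ⊆ closure (halfSpace n) := by
  intro x hx
  have h : Filter.Tendsto (fun k : ℕ => x + (1 / ((k : ℝ) + 1)) • (Pi.single 0 1 : Fin (n + 1) → ℝ))
      Filter.atTop (nhds (x + (0 : ℝ) • (Pi.single 0 1 : Fin (n + 1) → ℝ))) :=
    tendsto_const_nhds.add (tendsto_one_div_add_atTop_nhds_zero_nat.smul_const _)
  rw [zero_smul, add_zero] at h
  refine mem_closure_of_tendsto h (Filter.Eventually.of_forall fun k => ?_)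
  have : (0 : ℝ) < 1 / ((k : ℝ) + 1) := by positivity
  have hx0 : 0 ≤ x 0 := hx
  simp only [halfSpace, mem_ofPred_eq, Pi.add_apply, Pi.smul_apply, Pi.single_eq_same, smul_eq_mul,
    mul_one]
  linarith

theorem halfSpace_subset_closedHalfSpace : halfSpace n ⊆ closedHalfSpace n :=
  fun x (hx : 0 < x 0) => (hx.le : 0 ≤ x 0)

theorem slab_subset_closure (hT : 0 < T) :
    slab n T ⊆ closure (Ioo 0 T ×ˢ halfSpace n) := by
  rw [closure_prod_eq, closure_Ioo hT.ne]
  exact prod_mono Subset.rfl closedHalfSpace_subset_closure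

theorem isOpen_halfSpace : IsOpen (halfSpace n) :=
  isOpen_lt continuous_const (continuous_apply 0)

theorem isClosed_slab : IsClosed (slab n T) :=
  isClosed_Icc.prod (isClosed_le continuous_const (continuous_apply 0))

theorem Ioo_prod_halfSpace_subset_interior : Ioo 0 T ×ˢ halfSpace n ⊆ interior (slab n T) :=
  interior_maximal (prod_mono Ioo_subset_Icc_self halfSpace_subset_closedHalfSpace)
    (isOpen_Ioo.prod isOpen_halfSpace)

theorem slab_subset_closure_interior (hT : 0 < T) : slab n T ⊆ closure (interior (slab n T)) :=
  (slab_subset_closure hT).trans (closure_mono Ioo_prod_halfSpace_subset_interior)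

theorem convex_slab : Convex ℝ (slab n T) := by
  refine (convex_Icc 0 T).prod ?_
  intro x (hx : 0 ≤ x 0) y (hy : 0 ≤ y 0) a b ha hb _
  change 0 ≤ (a • x + b • y) 0
  simp only [Pi.add_apply, Pi.smul_apply, smul_eq_mul]
  positivity

theorem uniqueDiffOn_slab (hT : 0 < T) : UniqueDiffOn ℝ (slab n T) := by
  refine uniqueDiffOn_convex convex_slab ?_
  refine Set.Nonempty.mono Ioo_prod_halfSpace_subset_interior ⟨(T / 2, fun _ => 1), ?_⟩
  refine ⟨⟨by simpa using hT, by simpa using hT⟩, ?_⟩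
  simp [halfSpace]

theorem convex_bdrySlab : Convex ℝ (bdrySlab n T) := (convex_Icc 0 T).prod convex_univ

theorem Ioo_prod_univ_subset_interior :
    Ioo 0 T ×ˢ (univ : Set (Fin n → ℝ)) ⊆ interior (bdrySlab n T) :=
  interior_maximal (prod_mono Ioo_subset_Icc_self Subset.rfl) (isOpen_Ioo.prod isOpen_univ)

theorem bdrySlab_subset_closure_interior (hT : 0 < T) :
    bdrySlab n T ⊆ closure (interior (bdrySlab n T)) := by
  refine Subset.trans ?_ (closure_mono Ioo_prod_univ_subset_interior)
  rw [closure_prod_eq, closure_Ioo hT.ne, closure_univ]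
  exact Subset.rfl

theorem uniqueDiffOn_bdrySlab (hT : 0 < T) : UniqueDiffOn ℝ (bdrySlab n T) := by
  refine uniqueDiffOn_convex convex_bdrySlab ?_
  refine Set.Nonempty.mono Ioo_prod_univ_subset_interior ⟨(T / 2, 0), ?_⟩
  exact ⟨⟨by simpa using hT, by simpa using hT⟩, mem_univ _⟩

/-- An identity between continuous functions extends from `[0,T] × Ω` to its closure. -/
theorem eqOn_slab_of_halfSpace (hT : 0 < T) {Y : Type*} [TopologicalSpace Y] [T2Space Y]
    {f g : ℝ × (Fin (n + 1) → ℝ) → Y} (hf : ContinuousOn f (slab n T))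
    (hg : ContinuousOn g (slab n T)) (h : ∀ t ∈ Icc 0 T, ∀ x ∈ halfSpace n, f (t, x) = g (t, x)) :
    EqOn f g (slab n T) := by
  have h' : EqOn f g (Ioo 0 T ×ˢ halfSpace n) := fun z hz => h z.1 (Ioo_subset_Icc_self hz.1) z.2 hz.2
  exact h'.of_subset_closure hf hg (Ioo_prod_halfSpace_subset_interior.trans interior_subset)
    (slab_subset_closure hT)

/-- A bound of a continuous function extends from `[0,T] × Ω` to its closure. -/
theorem le_on_slab_of_halfSpace (hT : 0 < T) {f : ℝ × (Fin (n + 1) → ℝ) → ℝ} {C : ℝ}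
    (hf : ContinuousOn f (slab n T)) (h : ∀ t ∈ Icc 0 T, ∀ x ∈ halfSpace n, f (t, x) ≤ C) :
    ∀ z ∈ slab n T, f z ≤ C := by
  intro z hz
  have h1 := eqOn_slab_of_halfSpace (Y := ℝ) hT (hf.sup continuousOn_const)
    (continuousOn_const (c := C)) (fun t ht x hx => sup_eq_right.2 (h t ht x hx)) hz
  exact sup_eq_right.1 h1

end Domains

/-! ### The lifted derivatives in the slab -/

section Lift

variable {n : ℕ} {T : ℝ} {χ : ℝ → ℝ} {φ : ℝ × (Fin n → ℝ) → ℝ} {s : ℝ}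

/-- The time direction. -/
def dirT {k : ℕ} : ℝ × (Fin k → ℝ) := (1, 0)

/-- The space directions. -/
def dirX {k : ℕ} (i : Fin k) : ℝ × (Fin k → ℝ) := (0, Pi.single i 1)

/-- `∂ₜ^Φ`. -/
def dtL (D : Set (ℝ × (Fin (n + 1) → ℝ))) (Φ f : ℝ × (Fin (n + 1) → ℝ) → ℝ) :
    ℝ × (Fin (n + 1) → ℝ) → ℝ :=
  pd D Φ (dirX 0) dirT 0 f

/-- `∂ᵢ^Φ`. -/
def dxL (D : Set (ℝ × (Fin (n + 1) → ℝ))) (Φ : ℝ × (Fin (n + 1) → ℝ) → ℝ) (i : Fin (n + 1))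
    (f : ℝ × (Fin (n + 1) → ℝ) → ℝ) : ℝ × (Fin (n + 1) → ℝ) → ℝ :=
  pd D Φ (dirX 0) (dirX i) (if i = 0 then 1 else 0) f

/-- The constants `κ` are `∂ᵢ^Φ Φ`: with `κ = 1` for `i = 0`, the correction turns `∂₁` into `∂₁ /
∂₁Φ`. -/
theorem dxLift_eq_dxL {D : Set (ℝ × (Fin (n + 1) → ℝ))} {Φ f : ℝ × (Fin (n + 1) → ℝ) → ℝ}
    {z : ℝ × (Fin (n + 1) → ℝ)} (h : fderivWithin ℝ Φ D z (dirX 0) ≠ 0) (i : Fin (n + 1)) :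
    dxLift D Φ i f z = dxL D Φ i f z := by
  have h' : dx D 0 Φ z ≠ 0 := h
  by_cases hi : i = 0
  · subst hi
    change (if (0 : Fin (n + 1)) = 0 then dx D 0 f z / dx D 0 Φ z else _)
      = dx D 0 f z + ((if (0 : Fin (n + 1)) = 0 then 1 else 0) - dx D 0 Φ z) / dx D 0 Φ z
        * dx D 0 f z
    simp only [if_true]
    field_simp
    ring
  · change (if i = 0 then _ else dx D i f z - dx D i Φ z / dx D 0 Φ z * dx D 0 f z)
      = dx D i f z + ((if i = 0 then 1 else 0) - dx D i Φ z) / dx D 0 Φ z * dx D 0 f z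
    simp only [hi, if_false]
    ring

/-- The coordinate `(t,x) ↦ xᵢ`. -/
def coordL (n : ℕ) (i : Fin (n + 1)) : ℝ × (Fin (n + 1) → ℝ) →L[ℝ] ℝ :=
  (ContinuousLinearMap.proj i).comp (ContinuousLinearMap.snd ℝ ℝ (Fin (n + 1) → ℝ))

theorem coordL_apply (i : Fin (n + 1)) (z : ℝ × (Fin (n + 1) → ℝ)) : coordL n i z = z.2 i := rfl

/-- The projection `(t,x) ↦ (t,x')`. -/
def tailL (n : ℕ) : ℝ × (Fin (n + 1) → ℝ) →L[ℝ] ℝ × (Fin n → ℝ) :=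
  (ContinuousLinearMap.fst ℝ ℝ _).prod
    (ContinuousLinearMap.pi fun j : Fin n =>
      (ContinuousLinearMap.proj j.succ).comp (ContinuousLinearMap.snd ℝ ℝ (Fin (n + 1) → ℝ)))

theorem tailL_apply (z : ℝ × (Fin (n + 1) → ℝ)) : tailL n z = (z.1, Fin.tail z.2) := rfl

/-- The inclusion `(t,x') ↦ (t,(0,x'))`. -/
def bdryL (n : ℕ) : ℝ × (Fin n → ℝ) →L[ℝ] ℝ × (Fin (n + 1) → ℝ) :=
  (ContinuousLinearMap.fst ℝ ℝ _).prod
    (ContinuousLinearMap.pi fun i : Fin (n + 1) =>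
      Fin.cases (motive := fun _ => ℝ × (Fin n → ℝ) →L[ℝ] ℝ) 0
        (fun j => (ContinuousLinearMap.proj j).comp (ContinuousLinearMap.snd ℝ ℝ (Fin n → ℝ))) i)

theorem bdryL_apply (z : ℝ × (Fin n → ℝ)) : bdryL n z = (z.1, bdryPt z.2) := by
  refine Prod.ext rfl (funext fun i => ?_)
  refine Fin.cases ?_ (fun j => ?_) i <;> simp [bdryL, bdryPt]

theorem mapsTo_tailL : MapsTo (tailL n) (slab n T) (bdrySlab n T) := fun _ hz => ⟨hz.1, mem_univ _⟩

theorem mapsTo_bdryL : MapsTo (bdryL n) (bdrySlab n T) (slab n T) := fun z hz => by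
  rw [bdryL_apply]
  exact ⟨hz.1, by simp [closedHalfSpace, bdryPt]⟩

theorem bdryL_dirT : bdryL n dirT = dirT := by
  rw [bdryL_apply]
  refine Prod.ext rfl (funext fun i => ?_)
  refine Fin.cases ?_ (fun j => ?_) i <;> simp [dirT, bdryPt]

theorem bdryL_dirX (j : Fin n) : bdryL n (dirX j) = dirX j.succ := by
  rw [bdryL_apply]
  refine Prod.ext rfl (funext fun i => ?_)
  refine Fin.cases ?_ (fun k => ?_) i
  · simp [dirX, bdryPt]
  · simp [dirX, bdryPt, Pi.single_apply]

theorem fderivWithin_trace (hT : 0 < T) {f : ℝ × (Fin (n + 1) → ℝ) → ℝ}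
    (hf : DifferentiableOn ℝ f (slab n T)) {z : ℝ × (Fin n → ℝ)} (hz : z ∈ bdrySlab n T)
    (v : ℝ × (Fin n → ℝ)) :
    fderivWithin ℝ (fun y => f (bdryL n y)) (bdrySlab n T) z v
      = fderivWithin ℝ f (slab n T) (bdryL n z) (bdryL n v) := by
  have h : HasFDerivWithinAt (fun y => f (bdryL n y)) _ (bdrySlab n T) z :=
    (hf _ (mapsTo_bdryL hz)).hasFDerivWithinAt.comp z (bdryL n).hasFDerivWithinAt mapsTo_bdryL
  rw [h.fderivWithin (uniqueDiffOn_bdrySlab hT z hz)]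
  rfl

theorem contDiffOn_lift (hχ : IsCutoff χ) (hφ : ContDiffOn ℝ 2 φ (bdrySlab n T)) (s : ℝ) :
    ContDiffOn ℝ 2 (lift χ φ s) (slab n T) := by
  have h0 : ContDiff ℝ 2 fun z : ℝ × (Fin (n + 1) → ℝ) => z.2 0 :=
    (contDiff_apply ℝ ℝ (0 : Fin (n + 1))).comp contDiff_snd
  have hχ2 : ContDiff ℝ 2 χ := contDiff_infty.1 hχ.smooth 2
  exact (contDiff_const.mul h0).contDiffOn.add
    ((hχ2.comp h0).contDiffOn.mul (hφ.comp (tailL n).contDiff.contDiffOn mapsTo_tailL))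

theorem fderivWithin_lift_dirX_zero (hT : 0 < T) (hχ : IsCutoff χ)
    (hφ : ContDiffOn ℝ 2 φ (bdrySlab n T)) {z : ℝ × (Fin (n + 1) → ℝ)} (hz : z ∈ slab n T) :
    fderivWithin ℝ (lift χ φ s) (slab n T) z (dirX 0)
      = s + deriv χ (z.2 0) * φ (z.1, Fin.tail z.2) := by
  have h0 : HasFDerivWithinAt (fun z : ℝ × (Fin (n + 1) → ℝ) => z.2 0)
      (coordL n 0) (slab n T) z := (coordL n 0).hasFDerivWithinAt
  have h1 : HasFDerivWithinAt (fun y => φ (tailL n y)) _ (slab n T) z :=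
    (hφ.differentiableOn (by norm_num) _ (mapsTo_tailL hz)).hasFDerivWithinAt.comp z
      (tailL n).hasFDerivWithinAt mapsTo_tailL
  have h2 : HasDerivAt χ (deriv χ (z.2 0)) (z.2 0) :=
    (hχ.smooth.differentiable (by simp) _).hasDerivAt
  have h3 : HasFDerivWithinAt (lift χ φ s) _ (slab n T) z :=
    (h0.const_mul s).add ((h2.comp_hasFDerivWithinAt z h0).mul h1)
  have h4 : tailL n (dirX 0) = 0 := by
    rw [tailL_apply]
    refine Prod.ext rfl (funext fun i => ?_)
    simp [dirX, Fin.tail]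
  rw [h3.fderivWithin (uniqueDiffOn_slab hT z hz)]
  simp [h4, tailL_apply, coordL_apply]
  simp [dirX, mul_comm]

/-- Here `∂₁Φ = ±1 + χ' φ`, and `|χ' φ| < 2 / 4` by the bounds on `χ'` and `φ`. -/
theorem fderivWithin_lift_ne_zero (hT : 0 < T) (hχ : IsCutoff χ)
    (hφ : ContDiffOn ℝ 2 φ (bdrySlab n T)) (hφle : ∀ z ∈ bdrySlab n T, |φ z| ≤ 2)
    (hs : s * s = 1) : ∀ z ∈ slab n T, fderivWithin ℝ (lift χ φ s) (slab n T) z (dirX 0) ≠ 0 := by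
  intro z hz h
  rw [fderivWithin_lift_dirX_zero hT hχ hφ hz] at h
  have h1 := hχ.deriv_lt (z.2 0)
  have h2 := hφle _ (mapsTo_tailL hz)
  rw [tailL_apply] at h2
  have h3 : |s| = 1 := by
    rcases mul_self_eq_one_iff.1 hs with rfl | rfl <;> simp
  have h4 : |s| = |deriv χ (z.2 0)| * |φ (z.1, Fin.tail z.2)| := by
    rw [← abs_mul, ← abs_neg]; congr 1; linarith
  nlinarith [abs_nonneg (deriv χ (z.2 0))]

/-- The cut-off is constant near `0`, so `χ'(0) = 0` and `∂₁Φ = ±1` on `Σ`. -/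
theorem fderivWithin_lift_bdry_normal (hT : 0 < T) (hχ : IsCutoff χ)
    (hφ : ContDiffOn ℝ 2 φ (bdrySlab n T)) {z : ℝ × (Fin n → ℝ)} (hz : z ∈ bdrySlab n T) :
    fderivWithin ℝ (lift χ φ s) (slab n T) (bdryL n z) (dirX 0) = s := by
  rw [fderivWithin_lift_dirX_zero hT hχ hφ (mapsTo_bdryL hz), bdryL_apply]
  have h : χ =ᶠ[nhds 0] fun _ => 1 := by
    filter_upwards [Icc_mem_nhds (show (-1 : ℝ) < 0 by norm_num) (show (0 : ℝ) < 1 by norm_num)]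
      with r hr using hχ.eq_one r hr
  simp [bdryPt, h.deriv_eq]

/-- `Φ` has trace `φ` on `Σ`, since `χ(0) = 1`; tangential derivatives see only the trace. -/
theorem fderivWithin_lift_bdry (hT : 0 < T) (hχ : IsCutoff χ)
    (hφ : ContDiffOn ℝ 2 φ (bdrySlab n T)) {z : ℝ × (Fin n → ℝ)} (hz : z ∈ bdrySlab n T)
    (v : ℝ × (Fin n → ℝ)) :
    fderivWithin ℝ (lift χ φ s) (slab n T) (bdryL n z) (bdryL n v)
      = fderivWithin ℝ φ (bdrySlab n T) z v := by
  rw [← fderivWithin_trace hT ((contDiffOn_lift hχ hφ s).differentiableOn (by norm_num)) hz]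
  congr 2
  funext y
  rw [bdryL_apply]
  simp [lift, bdryPt, hχ.eq_one 0 (by simp)]

/-- The sum of a lifted transport derivative is a directional derivative. -/
theorem dtL_add_sum_dxL {D : Set (ℝ × (Fin (n + 1) → ℝ))} {Φ f : ℝ × (Fin (n + 1) → ℝ) → ℝ}
    {z : ℝ × (Fin (n + 1) → ℝ)} (a : Fin (n + 1) → ℝ) :
    dtL D Φ f z + ∑ i, a i * dxL D Φ i f z
      = fderivWithin ℝ f D z (((1 : ℝ), a) + ((a 0 - fderivWithin ℝ Φ D z ((1 : ℝ), a))
        / fderivWithin ℝ Φ D z (dirX 0)) • dirX 0) := by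
  have hdec : ((1 : ℝ), a) = dirT + ∑ i, a i • dirX i := by
    refine Prod.ext (by simp [dirT, dirX, Prod.fst_sum]) (funext fun k => ?_)
    simp [dirT, dirX, Prod.snd_sum, Pi.single_apply]
  have ha : a 0 = ∑ i, a i * (if i = 0 then 1 else 0) := by simp
  rw [hdec]
  conv_rhs => rw [ha]
  simp only [dtL, dxL, pd, map_add, map_sum, map_smul, smul_eq_mul, mul_add,
    Finset.sum_add_distrib]
  have : ∀ i, a i * (((if i = 0 then 1 else 0) - fderivWithin ℝ Φ D z (dirX i))
      / fderivWithin ℝ Φ D z (dirX 0) * fderivWithin ℝ f D z (dirX 0))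
      = (a i * (if i = 0 then 1 else 0) - a i * fderivWithin ℝ Φ D z (dirX i))
        * ((fderivWithin ℝ Φ D z (dirX 0))⁻¹ * fderivWithin ℝ f D z (dirX 0)) := fun i => by ring
  simp only [this, ← Finset.sum_mul, Finset.sum_sub_distrib]
  ring

/-- Provides the compactness for the transport argument in the coordinates `(Φ, x')`. These replace
`(x₁, x')` because the transport field moves them with speed `ν`, whereas its `x₁` component
involves derivatives of `φ`, for which no bound is assumed. As `|χ φ| ≤ 2`, a bound `R` on `Φ` gives
`R + 2` on `x₁`. -/
theorem isCompact_lift_le (hχ : IsCutoff χ)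
    (hφ : ContDiffOn ℝ 2 φ (bdrySlab n T)) (hφle : ∀ z ∈ bdrySlab n T, |φ z| ≤ 2)
    (hs : s * s = 1) (R : ℝ) :
    IsCompact {z ∈ slab n T | ∀ i : Fin (n + 1), |if i = 0 then lift χ φ s z else z.2 i| ≤ R} := by
  have hcont : ContinuousOn (fun (z : ℝ × (Fin (n + 1) → ℝ)) (i : Fin (n + 1)) =>
      if i = 0 then lift χ φ s z else z.2 i) (slab n T) := by
    refine continuousOn_pi.2 fun i => ?_
    by_cases hi : i = 0
    · simpa [hi] using (contDiffOn_lift hχ hφ s).continuousOn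
    · simp only [hi, if_false]; fun_prop
  have hcl := hcont.preimage_isClosed_of_isClosed isClosed_slab
    (t := Set.pi univ fun _ => Icc (-R) R) (isClosed_set_pi fun _ _ => isClosed_Icc)
  have hK : IsCompact (Icc 0 T ×ˢ (Set.pi univ fun _ : Fin (n + 1) => Icc (-(R + 2)) (R + 2))) :=
    isCompact_Icc.prod (isCompact_univ_pi fun _ => isCompact_Icc)
  convert hK.of_isClosed_subset hcl ?_ using 1
  · ext z
    simp only [mem_ofPred_eq, abs_le, mem_inter_iff, mem_preimage, mem_univ_pi, mem_Icc]
  · rintro z ⟨hz, hz'⟩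
    refine ⟨hz.1, fun i _ => ?_⟩
    have h := hz' i (mem_univ _)
    by_cases hi : i = 0
    · subst hi
      simp only [if_true] at h
      have h1 := hφle _ (mapsTo_tailL hz)
      rw [tailL_apply] at h1
      have h2 := hχ.mem_Icc (z.2 0)
      have h3 : |χ (z.2 0) * φ (z.1, Fin.tail z.2)| ≤ 2 := by
        rw [abs_mul, abs_of_nonneg h2.1]; nlinarith [h2.2, abs_nonneg (φ (z.1, Fin.tail z.2))]
      have h4 := abs_le.1 h3
      have h5 : -R ≤ lift χ φ s z ∧ lift χ φ s z ≤ R := h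
      simp only [lift] at h5
      rw [mem_Icc]
      rcases mul_self_eq_one_iff.1 hs with rfl | rfl <;> constructor <;> linarith [h5.1, h5.2]
    · simp only [hi, if_false] at h
      exact ⟨by linarith [h.1], by linarith [h.2]⟩

/-- If `∂ₜ^ΦF + ∇^Φ·Ψ + (∇^Φ·F) ν = 0` with `Ψ` antisymmetric and `ν` moving with the interface,
then the constraint `∇^Φ·F = 0` is preserved. -/
theorem preserved_divFreeAt (hT : 0 < T) (hχ : IsCutoff χ)
    (hφ : ContDiffOn ℝ 2 φ (bdrySlab n T)) (hφle : ∀ z ∈ bdrySlab n T, |φ z| ≤ 2)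
    (hs : s * s = 1) {F ν : ℝ × (Fin (n + 1) → ℝ) → Fin (n + 1) → ℝ}
    {Ψ : Fin (n + 1) → Fin (n + 1) → ℝ × (Fin (n + 1) → ℝ) → ℝ} {M : ℝ}
    (hF : ∀ i, ContDiffOn ℝ 2 (fun z => F z i) (slab n T))
    (hΨ : ∀ i j, ContDiffOn ℝ 2 (Ψ i j) (slab n T))
    (hν : ∀ i, ContDiffOn ℝ 1 (fun z => ν z i) (slab n T))
    (hνle : ∀ z ∈ slab n T, ∀ i, |ν z i| ≤ M)
    (hνN : ∀ z ∈ bdrySlab n T, dt (bdrySlab n T) φ z = ν (bdryL n z) ⬝ᵥ normalN T φ z)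
    (hanti : ∀ i j z, Ψ i j z = -Ψ j i z)
    (heq : ∀ z ∈ slab n T, ∀ i, dtL (slab n T) (lift χ φ s) (fun y => F y i) z
      + ∑ j, dxL (slab n T) (lift χ φ s) j (Ψ j i) z
      + (∑ j, dxL (slab n T) (lift χ φ s) j (fun y => F y j) z) * ν z i = 0) :
    Preserved T (DivFreeAt T (lift χ φ s) F) := by
  intro h0
  have hS := uniqueDiffOn_slab (n := n) hT
  have hΦ := contDiffOn_lift hχ hφ s
  have hne := fderivWithin_lift_ne_zero hT hχ hφ hφle hs
  set Φ := lift χ φ s with hΦdef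
  set D : ℝ × (Fin (n + 1) → ℝ) → ℝ := fun z => ∑ j, dxL (slab n T) Φ j (fun y => F y j) z with hD
  have hdiv : ∀ z ∈ slab n T, divLift (slab n T) Φ F z = D z := fun z hz =>
    Finset.sum_congr rfl fun i _ => dxLift_eq_dxL (hne z hz) i
  have hDc : ContDiffOn ℝ 1 D (slab n T) :=
    ContDiffOn.sum fun j _ => contDiffOn_pd hS (hF j) hΦ hne _ _
  -- The field of `∂ₜ^Φ + ν·∇^Φ`: its multiple of `e₁` is chosen so that `Φ` has derivative `ν₁`
  -- along it.
  set w : ℝ × (Fin (n + 1) → ℝ) → ℝ × (Fin (n + 1) → ℝ) := fun z =>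
    ((1 : ℝ), ν z) + ((ν z 0 - fderivWithin ℝ Φ (slab n T) z ((1 : ℝ), ν z))
        / fderivWithin ℝ Φ (slab n T) z (dirX 0)) • dirX 0 with hw
  have hM : 0 ≤ M := (abs_nonneg _).trans (hνle (0, 0) ⟨⟨le_rfl, hT.le⟩, by simp [closedHalfSpace]⟩ 0)
  -- The constraint is given only in the open half space; continuity on the slice `t = 0` adds `Σ`.
  have hD0 : ∀ z ∈ slab n T, z.1 = 0 → D z = 0 := by
    rintro ⟨t, x⟩ hz rfl
    have hcs : ContinuousOn (fun x => D (0, x)) (closedHalfSpace n) :=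
      hDc.continuousOn.comp (Continuous.prodMk_right 0).continuousOn fun x hx => ⟨hz.1, hx⟩
    have h1 : EqOn (fun x => D (0, x)) (fun _ => 0) (halfSpace n) := fun x hx => by
      have : (0, x) ∈ slab n T := ⟨hz.1, halfSpace_subset_closedHalfSpace hx⟩
      simpa [hdiv _ this] using h0 x hx
    exact h1.of_subset_closure hcs continuousOn_const halfSpace_subset_closedHalfSpace
      closedHalfSpace_subset_closure hz.2
  have key := eq_zero_of_transport hS convex_slab
    (ContinuousLinearMap.fst ℝ ℝ (Fin (n + 1) → ℝ)) (fun z hz => hz.1.1) (f := D)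
    (b := fun z => -∑ i, dxL (slab n T) Φ i (fun y => ν y i) z) (w := w)
    (y := fun (i : Fin (n + 1)) z => if i = 0 then Φ z else z.2 i) hM
    (hDc.differentiableOn (by norm_num))
    (continuousOn_finsetSum _ fun i _ => continuousOn_pd hS (hν i) hΦ hne _ _).neg
    (fun i => by
      by_cases hi : i = 0
      · simpa [hi] using hΦ.differentiableOn (by norm_num)
      · simp only [hi, if_false]; fun_prop)
    (isCompact_lift_le hχ hφ hφle hs) (fun z _ => by simp [hw, dirX])
    (fun z hz i => by
      by_cases hi : i = 0
      · subst hi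
        have : fderivWithin ℝ Φ (slab n T) z (w z) = ν z 0 := by
          simp only [hw, map_add, map_smul, smul_eq_mul]
          rw [div_mul_cancel₀ _ (hne z hz)]; ring
        simpa [this] using hνle z hz 0
      · have h1 : HasFDerivWithinAt (fun z : ℝ × (Fin (n + 1) → ℝ) => z.2 i)
          (coordL n i) (slab n T) z := (coordL n i).hasFDerivWithinAt
        simp only [hi, if_false]
        rw [h1.fderivWithin (hS z hz)]
        simpa [hw, dirX, hi, coordL_apply] using hνle z hz i)
    (by
      rintro ⟨t, x⟩ hz (ht : 0 < t)
      have hz1 : t ≤ T := hz.1.2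
      have hx : 0 ≤ x 0 := hz.2
      have hw1 : (w (t, x)).1 = 1 := by simp [hw, dirX]
      have hmem : ∀ δ : ℝ, 0 < δ → δ ≤ t → δ * (w (t, x)).2 0 ≤ x 0 →
          (t, x) - δ • w (t, x) ∈ slab n T := by
        intro δ hδ hδt hδx
        refine ⟨?_, ?_⟩
        · simp only [Prod.fst_sub, Prod.smul_fst, hw1, smul_eq_mul, mul_one]
          exact ⟨by linarith, by linarith⟩
        · change 0 ≤ ((t, x) - δ • w (t, x)).2 0
          simp only [Prod.snd_sub, Prod.smul_snd, Pi.sub_apply, Pi.smul_apply, smul_eq_mul]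
          linarith
      -- At a boundary point the condition `∂ₜφ = ν·N` makes `w` tangent to `Σ`, so the backward
      -- line stays on `Σ` until time `0` and `δ = t` works. In the interior a short enough step
      -- keeps `x₁ ≥ 0`.
      rcases hx.eq_or_lt with hx0 | hx0
      · refine ⟨t, ht, hmem t ht le_rfl ?_⟩
        have hzb : (t, Fin.tail x) ∈ bdrySlab n T := ⟨hz.1, mem_univ _⟩
        have hxb : (t, x) = bdryL n (t, Fin.tail x) := by
          rw [bdryL_apply]
          refine Prod.ext rfl ?_
          simp only [bdryPt, hx0]
          exact (Fin.cons_self_tail x).symm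
        have h1 : fderivWithin ℝ Φ (slab n T) (t, x) ((1 : ℝ), ν (t, x))
            = s * ν (t, x) 0 + dt (bdrySlab n T) φ (t, Fin.tail x)
              + ∑ j : Fin n, ν (t, x) j.succ * dx (bdrySlab n T) j φ (t, Fin.tail x) := by
          have hdec : ((1 : ℝ), ν (t, x)) = ν (t, x) 0 • dirX 0 + bdryL n dirT
              + ∑ j : Fin n, ν (t, x) j.succ • bdryL n (dirX j) := by
            simp only [bdryL_dirT, bdryL_dirX]
            refine Prod.ext (by simp [dirT, dirX, Prod.fst_sum]) (funext fun k => ?_)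
            refine Fin.cases ?_ (fun k => ?_) k <;>
              simp [dirT, dirX, Prod.snd_sum, Pi.single_apply]
          rw [hdec]
          simp only [map_add, map_sum, map_smul, smul_eq_mul]
          rw [hxb, fderivWithin_lift_bdry_normal hT hχ hφ hzb]
          simp only [hΦdef, fderivWithin_lift_bdry hT hχ hφ hzb]
          rw [mul_comm]; rfl
        have h2 := hνN _ hzb
        rw [← hxb] at h2
        simp only [dotProduct, Fin.sum_univ_succ, normalN, Fin.cons_zero, Fin.cons_succ, mul_one,
          mul_neg, Finset.sum_neg_distrib] at h2
        have h3 : fderivWithin ℝ Φ (slab n T) (t, x) (dirX 0) = s := by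
          rw [hxb]; exact fderivWithin_lift_bdry_normal hT hχ hφ hzb
        have hs0 : s ≠ 0 := fun h => by simp [h] at hs
        have h4 : (w (t, x)).2 0 = 0 := by
          simp only [hw, h1, h3, h2]
          simp [dirX]
          field_simp
          ring
        rw [h4, ← hx0, mul_zero]
      · have hpos : 0 < x 0 / (|(w (t, x)).2 0| + 1) := by positivity
        refine ⟨min t (x 0 / (|(w (t, x)).2 0| + 1)), lt_min ht hpos,
          hmem _ (lt_min ht hpos) (min_le_left _ _) ?_⟩
        have h1 : min t (x 0 / (|(w (t, x)).2 0| + 1)) * (w (t, x)).2 0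
            ≤ (x 0 / (|(w (t, x)).2 0| + 1)) * (|(w (t, x)).2 0| + 1) :=
          mul_le_mul_of_nonneg (min_le_right _ _) (by linarith [le_abs_self ((w (t, x)).2 0)])
            (lt_min ht hpos).le (by positivity)
        rwa [div_mul_cancel₀ _ (by positivity)] at h1)
    (fun z hz => by
      have h1 := transport_divergence hS (slab_subset_closure_interior hT) hΦ hne dirT
        (dirX (k := n + 1)) 0 (fun i => if i = 0 then 1 else 0) (F := fun i z => F z i)
        (ν := fun i z => ν z i) hF hΨ hν hanti heq hz
      have h2 := dtL_add_sum_dxL (D := slab n T) (Φ := Φ) (f := D) (z := z) (ν z)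
      rw [← h2]
      simp only [dtL, dxL, hD] at h1 ⊢
      linarith)
    hD0
  intro t ht x hx
  have hz : (t, x) ∈ slab n T := ⟨ht, halfSpace_subset_closedHalfSpace hx⟩
  rw [hdiv _ hz]
  exact key _ hz

end Lift

/-! ### Evolution of the normal component on the interface -/

section Boundary

variable {n : ℕ} {T : ℝ} {χ : ℝ → ℝ} {φ : ℝ × (Fin n → ℝ) → ℝ} {s : ℝ}

/-- On `Σ` a lifted derivative is the tangential derivative of the trace plus a multiple of `s ∂₁f`
(note `s⁻¹ = s`). The multiple is `-∂ₜφ` for time, and the next two lemmas give `Nᵢ` for the `i`-th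
space direction. -/
theorem dtL_bdry (hT : 0 < T) (hχ : IsCutoff χ) (hφ : ContDiffOn ℝ 2 φ (bdrySlab n T))
    (hs : s * s = 1) {f : ℝ × (Fin (n + 1) → ℝ) → ℝ} (hf : DifferentiableOn ℝ f (slab n T))
    {z : ℝ × (Fin n → ℝ)} (hz : z ∈ bdrySlab n T) :
    dtL (slab n T) (lift χ φ s) f (bdryL n z)
      = dt (bdrySlab n T) (fun y => f (bdryL n y)) z
        - dt (bdrySlab n T) φ z * s * fderivWithin ℝ f (slab n T) (bdryL n z) (dirX 0) := by
  have hs0 : s ≠ 0 := fun h => by simp [h] at hs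
  have h1 := fderivWithin_lift_bdry (s := s) hT hχ hφ hz dirT
  have h2 := fderivWithin_trace hT hf hz dirT
  rw [bdryL_dirT] at h1 h2
  simp only [dtL, pd]
  rw [h1, fderivWithin_lift_bdry_normal hT hχ hφ hz, ← h2]
  change dt (bdrySlab n T) (fun y => f (bdryL n y)) z
    + (0 - dt (bdrySlab n T) φ z) / s * _ = _
  field_simp
  linear_combination (dt (bdrySlab n T) φ z) *
    (fderivWithin ℝ f (slab n T) (bdryL n z)) (dirX 0) * hs

theorem dxL_bdry_zero (hT : 0 < T) (hχ : IsCutoff χ) (hφ : ContDiffOn ℝ 2 φ (bdrySlab n T))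
    (hs : s * s = 1) {f : ℝ × (Fin (n + 1) → ℝ) → ℝ}
    {z : ℝ × (Fin n → ℝ)} (hz : z ∈ bdrySlab n T) :
    dxL (slab n T) (lift χ φ s) 0 f (bdryL n z)
      = s * fderivWithin ℝ f (slab n T) (bdryL n z) (dirX 0) := by
  have hs0 : s ≠ 0 := fun h => by simp [h] at hs
  simp only [dxL, pd, if_true]
  rw [fderivWithin_lift_bdry_normal hT hχ hφ hz]
  field_simp
  linear_combination -(fderivWithin ℝ f (slab n T) (bdryL n z)) (dirX 0) * hs

theorem dxL_bdry_succ (hT : 0 < T) (hχ : IsCutoff χ) (hφ : ContDiffOn ℝ 2 φ (bdrySlab n T))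
    (hs : s * s = 1) {f : ℝ × (Fin (n + 1) → ℝ) → ℝ} (hf : DifferentiableOn ℝ f (slab n T))
    {z : ℝ × (Fin n → ℝ)} (hz : z ∈ bdrySlab n T) (j : Fin n) :
    dxL (slab n T) (lift χ φ s) j.succ f (bdryL n z)
      = dx (bdrySlab n T) j (fun y => f (bdryL n y)) z
        - dx (bdrySlab n T) j φ z * s * fderivWithin ℝ f (slab n T) (bdryL n z) (dirX 0) := by
  have hs0 : s ≠ 0 := fun h => by simp [h] at hs
  have h1 := fderivWithin_lift_bdry (s := s) hT hχ hφ hz (dirX j)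
  have h2 := fderivWithin_trace hT hf hz (dirX j)
  rw [bdryL_dirX] at h1 h2
  simp only [dxL, pd, Fin.succ_ne_zero, if_false]
  rw [h1, fderivWithin_lift_bdry_normal hT hχ hφ hz, ← h2]
  change dx (bdrySlab n T) j (fun y => f (bdryL n y)) z
    + (0 - dx (bdrySlab n T) j φ z) / s * _ = _
  field_simp
  linear_combination (dx (bdrySlab n T) j φ z) *
    (fderivWithin ℝ f (slab n T) (bdryL n z)) (dirX 0) * hs

theorem contDiffOn_normalN (hT : 0 < T) (hφ : ContDiffOn ℝ 2 φ (bdrySlab n T)) (i : Fin (n + 1)) :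
    ContDiffOn ℝ 1 (fun z => normalN T φ z i) (bdrySlab n T) := by
  refine Fin.cases ?_ (fun j => ?_) i
  · simpa [normalN] using contDiffOn_const
  · simpa [normalN, dx, dirX] using
      (contDiffOn_fderivWithin_apply (uniqueDiffOn_bdrySlab hT) hφ (dirX j)).neg

/-- Uniqueness for a linear transport equation on `[0,T] × ℝⁿ` with bounded velocity. -/
theorem eq_zero_of_transport_bdrySlab (hT : 0 < T) {G b : ℝ × (Fin n → ℝ) → ℝ}
    {β : ℝ × (Fin n → ℝ) → Fin n → ℝ} {M : ℝ} (hM : 0 ≤ M)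
    (hG : DifferentiableOn ℝ G (bdrySlab n T)) (hb : ContinuousOn b (bdrySlab n T))
    (hβ : ∀ z ∈ bdrySlab n T, ∀ i, |β z i| ≤ M)
    (heq : ∀ z ∈ bdrySlab n T, dt (bdrySlab n T) G z + ∑ j, β z j * dx (bdrySlab n T) j G z
      = b z * G z)
    (hinit : ∀ x, G (0, x) = 0) : ∀ z ∈ bdrySlab n T, G z = 0 := by
  have hS := uniqueDiffOn_bdrySlab (n := n) hT
  refine eq_zero_of_transport hS convex_bdrySlab
    (ContinuousLinearMap.fst ℝ ℝ (Fin n → ℝ)) (fun z hz => hz.1.1) (f := G) (b := b)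
    (w := fun z => ((1 : ℝ), β z)) (y := fun (i : Fin n) z => z.2 i) hM hG hb
    (fun i => by fun_prop) ?_ (fun z _ => by simp) ?_ ?_ ?_ ?_
  · intro R
    have hK : IsCompact (Icc 0 T ×ˢ (Set.pi univ fun _ : Fin n => Icc (-R) R)) :=
      isCompact_Icc.prod (isCompact_univ_pi fun _ => isCompact_Icc)
    have h : {z ∈ bdrySlab n T | ∀ i, |z.2 i| ≤ R}
        = Icc 0 T ×ˢ (Set.pi univ fun _ : Fin n => Icc (-R) R) := by
      ext z
      simp only [bdrySlab, mem_ofPred_eq, mem_prod, mem_univ, and_true, mem_univ_pi, abs_le, mem_Icc]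
    rwa [h]
  · intro z hz i
    have h1 : HasFDerivWithinAt (fun z : ℝ × (Fin n → ℝ) => z.2 i)
        ((ContinuousLinearMap.proj (R := ℝ) (φ := fun _ : Fin n => ℝ) i).comp
          (ContinuousLinearMap.snd ℝ ℝ (Fin n → ℝ))) (bdrySlab n T) z :=
      ((ContinuousLinearMap.proj (R := ℝ) (φ := fun _ : Fin n => ℝ) i).comp
          (ContinuousLinearMap.snd ℝ ℝ (Fin n → ℝ))).hasFDerivWithinAt
    rw [h1.fderivWithin (hS z hz)]
    simpa using hβ z hz i
  · rintro ⟨t, x⟩ hz (ht : 0 < t)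
    exact ⟨t, ht, ⟨by simp [hT.le], mem_univ _⟩⟩
  · intro z hz
    rw [← heq z hz]
    have hdec : ((1 : ℝ), β z) = dirT + ∑ j, β z j • dirX j := by
      refine Prod.ext (by simp [dirT, dirX, Prod.fst_sum]) (funext fun k => ?_)
      simp [dirT, dirX, Prod.snd_sum, Pi.single_apply]
    rw [hdec, map_add, map_sum]
    simp only [map_smul, smul_eq_mul]
    rfl
  · rintro ⟨t, x⟩ _ (ht : t = 0)
    rw [ht, hinit]

/-- The evolution of `F·N` on the boundary. -/
theorem transport_normal (hT : 0 < T) (hχ : IsCutoff χ) (hφ : ContDiffOn ℝ 2 φ (bdrySlab n T))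
    (hs : s * s = 1) {F ν : ℝ × (Fin (n + 1) → ℝ) → Fin (n + 1) → ℝ}
    {Ψ : Fin (n + 1) → Fin (n + 1) → ℝ × (Fin (n + 1) → ℝ) → ℝ}
    {β : ℝ × (Fin n → ℝ) → Fin n → ℝ}
    (hF : ∀ i, ContDiffOn ℝ 1 (fun z => F z i) (slab n T))
    (hΨ : ∀ i j, ContDiffOn ℝ 1 (Ψ i j) (slab n T))
    (hβ : ∀ j, ContDiffOn ℝ 1 (fun z => β z j) (bdrySlab n T))
    (hνN : ∀ z ∈ bdrySlab n T, dt (bdrySlab n T) φ z = ν (bdryL n z) ⬝ᵥ normalN T φ z)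
    (hanti : ∀ i j z, Ψ i j z = -Ψ j i z)
    (htan : ∀ z ∈ bdrySlab n T, ∀ j : Fin n, ∑ i, Ψ j.succ i (bdryL n z) * normalN T φ z i
      = β z j * (F (bdryL n z) ⬝ᵥ normalN T φ z) - F (bdryL n z) j.succ * dt (bdrySlab n T) φ z)
    {z : ℝ × (Fin n → ℝ)} (hz : z ∈ bdrySlab n T)
    (heq : ∀ i, dtL (slab n T) (lift χ φ s) (fun y => F y i) (bdryL n z)
      + ∑ j, dxL (slab n T) (lift χ φ s) j (Ψ j i) (bdryL n z)
      + (∑ j, dxL (slab n T) (lift χ φ s) j (fun y => F y j) (bdryL n z)) * ν (bdryL n z) i = 0) :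
    dt (bdrySlab n T) (fun y => F (bdryL n y) ⬝ᵥ normalN T φ y) z
      + ∑ j, β z j * dx (bdrySlab n T) j (fun y => F (bdryL n y) ⬝ᵥ normalN T φ y) z
      = -(∑ j, dx (bdrySlab n T) j (fun y => β y j) z) * (F (bdryL n z) ⬝ᵥ normalN T φ z) := by
  have hB := uniqueDiffOn_bdrySlab (n := n) hT
  have dF : ∀ i, DifferentiableOn ℝ (fun z => F z i) (slab n T) := fun i =>
    (hF i).differentiableOn (by norm_num)
  have dΨ : ∀ i j, DifferentiableOn ℝ (Ψ i j) (slab n T) := fun i j =>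
    (hΨ i j).differentiableOn (by norm_num)
  have dtr : ∀ {f : ℝ × (Fin (n + 1) → ℝ) → ℝ}, DifferentiableOn ℝ f (slab n T) →
      DifferentiableWithinAt ℝ (fun y => f (bdryL n y)) (bdrySlab n T) z := fun hf =>
    (hf _ (mapsTo_bdryL hz)).comp z (bdryL n).differentiableWithinAt mapsTo_bdryL
  have dN : ∀ i, DifferentiableWithinAt ℝ (fun y => normalN T φ y i) (bdrySlab n T) z := fun i =>
    (contDiffOn_normalN hT hφ i).differentiableOn (by norm_num) z hz
  have dβ : ∀ j, DifferentiableWithinAt ℝ (fun y => β y j) (bdrySlab n T) z := fun i =>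
    (hβ i).differentiableOn (by norm_num) z hz
  have dφt : DifferentiableWithinAt ℝ (fun y => dt (bdrySlab n T) φ y) (bdrySlab n T) z :=
    (contDiffOn_fderivWithin_apply hB hφ dirT).differentiableOn (by norm_num) z hz
  have dG : DifferentiableWithinAt ℝ (fun y => F (bdryL n y) ⬝ᵥ normalN T φ y) (bdrySlab n T) z :=
    DifferentiableWithinAt.fun_sum fun i _ => (dtr (dF i)).fun_mul (dN i)
  -- second derivatives of the interface
  have hN0 : ∀ v, fderivWithin ℝ (fun y => normalN T φ y 0) (bdrySlab n T) z v = 0 := by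
    intro v; simp [normalN]
  have hNs : ∀ (k : Fin n) v, fderivWithin ℝ (fun y => normalN T φ y k.succ) (bdrySlab n T) z v
      = -fderivWithin ℝ (fun y => fderivWithin ℝ φ (bdrySlab n T) y v) (bdrySlab n T) z (dirX k) := by
    intro k v
    rw [← fderivWithin_apply_comm hB (bdrySlab_subset_closure_interior hT) hφ hz]
    simp only [normalN, Fin.cons_succ]
    rw [fderivWithin_fun_neg (hB z hz)]
    rfl
  -- the equation dotted with the normal
  set p : (ℝ × (Fin (n + 1) → ℝ) → ℝ) → ℝ := fun f =>
    fderivWithin ℝ f (slab n T) (bdryL n z) (dirX 0) with hp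
  set φt := dt (bdrySlab n T) φ z with hφt
  set N := normalN T φ z with hN
  have hNsz : ∀ j : Fin n, N j.succ = -dx (bdrySlab n T) j φ z := fun j => by simp [hN, normalN]
  have hNz : N 0 = 1 := by simp [hN, normalN]
  set tan : Fin (n + 1) → (ℝ × (Fin (n + 1) → ℝ) → ℝ) → ℝ := fun i f =>
    Fin.cases (motive := fun _ => ℝ) 0
      (fun j => dx (bdrySlab n T) j (fun y => f (bdryL n y)) z) i with htandef
  have hdx : ∀ {f : ℝ × (Fin (n + 1) → ℝ) → ℝ}, DifferentiableOn ℝ f (slab n T) → ∀ i,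
      dxL (slab n T) (lift χ φ s) i f (bdryL n z) = tan i f + N i * (s * p f) := by
    intro f hf i
    refine Fin.cases ?_ (fun j => ?_) i
    · rw [dxL_bdry_zero hT hχ hφ hs hz, hNz]; simp [htandef, hp]
    · rw [dxL_bdry_succ hT hχ hφ hs hf hz, hNsz]; simp only [htandef, hp, Fin.cases_succ]; ring
  have h1 : ∀ i, (dt (bdrySlab n T) (fun y => F (bdryL n y) i) z - φt * s * p (fun y => F y i))
      + ∑ j, (tan j (Ψ j i) + N j * (s * p (Ψ j i)))
      + (∑ j, (tan j (fun y => F y j) + N j * (s * p (fun y => F y j)))) * ν (bdryL n z) i = 0 := by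
    intro i
    rw [← heq i, dtL_bdry hT hχ hφ hs (dF i) hz]
    simp only [hdx (dF _), hdx (dΨ _ _)]
    rfl
  have h2 : ∑ i, N i * ((dt (bdrySlab n T) (fun y => F (bdryL n y) i) z - φt * s * p (fun y => F y i))
      + ∑ j, (tan j (Ψ j i) + N j * (s * p (Ψ j i)))
      + (∑ j, (tan j (fun y => F y j) + N j * (s * p (fun y => F y j)))) * ν (bdryL n z) i) = 0 :=
    Finset.sum_eq_zero fun i _ => by rw [h1 i, mul_zero]
  -- The symmetric tensor `N ⊗ N` is contracted with the antisymmetric normal derivative of `Ψ`.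
  have hpanti : ∑ i, N i * ∑ j, N j * (s * p (Ψ j i)) = 0 := by
    have hpi : ∀ i j, p (Ψ j i) = -p (Ψ i j) := by
      intro i j
      have : Ψ j i = fun y => -Ψ i j y := funext fun y => hanti j i y
      simp only [hp]
      rw [this, fderivWithin_fun_neg (uniqueDiffOn_slab hT _ (mapsTo_bdryL hz))]
      rfl
    have : ∑ i, N i * ∑ j, N j * (s * p (Ψ j i)) = -∑ i, N i * ∑ j, N j * (s * p (Ψ j i)) := by
      simp only [Finset.mul_sum]
      conv_lhs => rw [Finset.sum_comm]
      rw [← Finset.sum_neg_distrib]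
      refine Finset.sum_congr rfl fun j _ => ?_
      rw [← Finset.sum_neg_distrib]
      refine Finset.sum_congr rfl fun i _ => ?_
      rw [hpi j i]; ring
    linarith
  have hνN' : ∑ i, N i * ν (bdryL n z) i = φt := by
    rw [hφt, hνN z hz]; exact Finset.sum_congr rfl fun i _ => mul_comm _ _
  -- Only tangential derivatives are left: the normal ones of `F` come once with `-∂ₜφ` from `∂ₜ^Φ
  -- F`, and once with `ν·N = ∂ₜφ` from the term `(∇^Φ·F) ν`.
  have h3 : ∑ i, N i * dt (bdrySlab n T) (fun y => F (bdryL n y) i) z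
      + ∑ i, N i * ∑ j, tan j (Ψ j i) + φt * ∑ j, tan j (fun y => F y j) = 0 := by
    set Q := ∑ j, (tan j (fun y => F y j) + N j * (s * p (fun y => F y j))) with hQ
    have e1 : ∑ i, N i * ((dt (bdrySlab n T) (fun y => F (bdryL n y) i) z
        - φt * s * p (fun y => F y i)) + ∑ j, (tan j (Ψ j i) + N j * (s * p (Ψ j i)))
        + Q * ν (bdryL n z) i)
        = ∑ i, N i * dt (bdrySlab n T) (fun y => F (bdryL n y) i) z
          - φt * ∑ i, N i * (s * p (fun y => F y i))
          + (∑ i, N i * ∑ j, tan j (Ψ j i) + ∑ i, N i * ∑ j, N j * (s * p (Ψ j i)))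
          + Q * ∑ i, N i * ν (bdryL n z) i := by
      simp only [Finset.mul_sum (s := Finset.univ) (a := φt), Finset.mul_sum (s := Finset.univ) (a := Q),
        ← Finset.sum_add_distrib, ← Finset.sum_sub_distrib]
      refine Finset.sum_congr rfl fun i _ => ?_
      rw [Finset.sum_add_distrib]; ring
    rw [h2, hpanti, hνN', hQ, Finset.sum_add_distrib] at e1
    linarith
  -- the tangential part of the boundary condition, differentiated
  have h4 : ∀ j : Fin n,
      ∑ i, (Ψ j.succ i (bdryL n z) * dx (bdrySlab n T) j (fun y => normalN T φ y i) z
        + N i * tan j.succ (Ψ j.succ i))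
      = β z j * dx (bdrySlab n T) j (fun y => F (bdryL n y) ⬝ᵥ normalN T φ y) z
        + (F (bdryL n z) ⬝ᵥ N) * dx (bdrySlab n T) j (fun y => β y j) z
        - (F (bdryL n z) j.succ * dx (bdrySlab n T) j (fun y => dt (bdrySlab n T) φ y) z
          + φt * tan j.succ (fun y => F y j.succ)) := by
    intro j
    have hE : EqOn (fun z => ∑ i, Ψ j.succ i (bdryL n z) * normalN T φ z i)
      (fun z => β z j * (F (bdryL n z) ⬝ᵥ normalN T φ z)
        - F (bdryL n z) j.succ * dt (bdrySlab n T) φ z) (bdrySlab n T) := fun z hz => htan z hz j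
    have h := congrArg (fun l : ℝ × (Fin n → ℝ) →L[ℝ] ℝ => l (dirX j))
      (fderivWithin_congr (𝕜 := ℝ) hE (hE hz))
    rw [fderivWithin_fun_sum (hB z hz) (fun i _ => (dtr (dΨ _ i)).fun_mul (dN i)),
      fderivWithin_fun_sub (hB z hz) ((dβ j).fun_mul dG) ((dtr (dF _)).fun_mul dφt),
      fderivWithin_fun_mul (hB z hz) (dβ j) dG,
      fderivWithin_fun_mul (hB z hz) (dtr (dF _)) dφt,
      Finset.sum_congr rfl fun i _ => fderivWithin_fun_mul (hB z hz) (dtr (dΨ _ i)) (dN i)] at h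
    simp only [add_apply, sub_apply, sum_apply, smul_apply, smul_eq_mul] at h
    exact h
  have h5 := Finset.sum_congr (s₁ := Finset.univ) rfl fun j _ => h4 j
  simp only [Finset.sum_add_distrib, Finset.sum_sub_distrib] at h5
  -- The derivatives of `N` form minus the Hessian of `φ`, which is symmetric and contracts to zero
  -- with `Ψ`; the column `i = 0` is absent because `N₁ = 1`.
  have h6 : ∑ j : Fin n, ∑ i, Ψ j.succ i (bdryL n z)
      * dx (bdrySlab n T) j (fun y => normalN T φ y i) z = 0 := by
    set A := ∑ j : Fin n, ∑ i, Ψ j.succ i (bdryL n z)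
      * dx (bdrySlab n T) j (fun y => normalN T φ y i) z with hA
    have e : A = ∑ j : Fin n, ∑ k : Fin n, Ψ j.succ k.succ (bdryL n z)
        * dx (bdrySlab n T) j (fun y => normalN T φ y k.succ) z := by
      refine Finset.sum_congr rfl fun j _ => ?_
      rw [Fin.sum_univ_succ, dx, hN0, mul_zero, zero_add]
    have e' : A = -A := by
      conv_lhs => rw [e, Finset.sum_comm]
      rw [e, ← Finset.sum_neg_distrib]
      refine Finset.sum_congr rfl fun j _ => ?_
      rw [← Finset.sum_neg_distrib]
      refine Finset.sum_congr rfl fun k _ => ?_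
      rw [hanti k.succ j.succ, neg_mul]
      congr 2
      simp only [dx]
      have a1 := hNs j (dirX k)
      have a2 := hNs k (dirX j)
      rw [fderivWithin_apply_comm hB (bdrySlab_subset_closure_interior hT) hφ hz] at a1
      exact a1.trans a2.symm
    linarith
  have h7 : ∑ i, N i * ∑ j, tan j (Ψ j i) = ∑ j : Fin n, ∑ i, N i * tan j.succ (Ψ j.succ i) := by
    rw [Finset.sum_comm]
    refine Finset.sum_congr rfl fun i _ => ?_
    rw [Fin.sum_univ_succ, ← Finset.mul_sum]
    simp [htandef]
  have h8 : ∑ j, tan j (fun y => F y j) = ∑ j : Fin n, tan j.succ (fun y => F y j.succ) := by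
    rw [Fin.sum_univ_succ]; simp [htandef]
  -- The time derivative of `N` produces `-Fⱼ ∂ⱼ∂ₜφ`, which cancels the same term of the
  -- differentiated boundary condition `h5`.
  have h9 : dt (bdrySlab n T) (fun y => F (bdryL n y) ⬝ᵥ normalN T φ y) z
      = ∑ i, N i * dt (bdrySlab n T) (fun y => F (bdryL n y) i) z
        - ∑ j : Fin n, F (bdryL n z) j.succ
          * dx (bdrySlab n T) j (fun y => dt (bdrySlab n T) φ y) z := by
    have e : dt (bdrySlab n T) (fun y => F (bdryL n y) ⬝ᵥ normalN T φ y) z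
        = ∑ i, (F (bdryL n z) i * dt (bdrySlab n T) (fun y => normalN T φ y i) z
          + N i * dt (bdrySlab n T) (fun y => F (bdryL n y) i) z) := by
      simp only [dt, dotProduct]
      rw [fderivWithin_fun_sum (hB z hz) (fun i _ => (dtr (dF i)).fun_mul (dN i)),
        Finset.sum_congr rfl fun i _ => fderivWithin_fun_mul (hB z hz) (dtr (dF i)) (dN i)]
      simp only [add_apply, sum_apply, smul_apply, smul_eq_mul]
      rfl
    have e' : ∑ i, F (bdryL n z) i * dt (bdrySlab n T) (fun y => normalN T φ y i) z
        = -∑ j : Fin n, F (bdryL n z) j.succ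
          * dx (bdrySlab n T) j (fun y => dt (bdrySlab n T) φ y) z := by
      rw [Fin.sum_univ_succ, dt, hN0, mul_zero, zero_add, ← Finset.sum_neg_distrib]
      refine Finset.sum_congr rfl fun j _ => ?_
      rw [dt, hNs, mul_neg]; rfl
    rw [e, Finset.sum_add_distrib, e']; ring
  rw [h6, ← h7, ← Finset.mul_sum, ← Finset.mul_sum, ← h8] at h5
  linarith

/-- If moreover the tangential part of `Ψ` is the one of a flow carried by the interface, then the
constraint `F·N = 0` is preserved. -/
theorem preserved_tangentAt (hT : 0 < T) (hχ : IsCutoff χ) (hφ : ContDiffOn ℝ 2 φ (bdrySlab n T))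
    (hs : s * s = 1) {F ν : ℝ × (Fin (n + 1) → ℝ) → Fin (n + 1) → ℝ}
    {Ψ : Fin (n + 1) → Fin (n + 1) → ℝ × (Fin (n + 1) → ℝ) → ℝ}
    {β : ℝ × (Fin n → ℝ) → Fin n → ℝ} {M : ℝ} (hM : 0 ≤ M)
    (hF : ∀ i, ContDiffOn ℝ 1 (fun z => F z i) (slab n T))
    (hΨ : ∀ i j, ContDiffOn ℝ 1 (Ψ i j) (slab n T))
    (hβ : ∀ j, ContDiffOn ℝ 1 (fun z => β z j) (bdrySlab n T))
    (hβM : ∀ z ∈ bdrySlab n T, ∀ j, |β z j| ≤ M)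
    (hνN : ∀ z ∈ bdrySlab n T, dt (bdrySlab n T) φ z = ν (bdryL n z) ⬝ᵥ normalN T φ z)
    (hanti : ∀ i j z, Ψ i j z = -Ψ j i z)
    (htan : ∀ z ∈ bdrySlab n T, ∀ j : Fin n, ∑ i, Ψ j.succ i (bdryL n z) * normalN T φ z i
      = β z j * (F (bdryL n z) ⬝ᵥ normalN T φ z) - F (bdryL n z) j.succ * dt (bdrySlab n T) φ z)
    (heq : ∀ z ∈ slab n T, ∀ i, dtL (slab n T) (lift χ φ s) (fun y => F y i) z
      + ∑ j, dxL (slab n T) (lift χ φ s) j (Ψ j i) z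
      + (∑ j, dxL (slab n T) (lift χ φ s) j (fun y => F y j) z) * ν z i = 0) :
    Preserved T (TangentAt T φ F) := by
  intro h0 t ht x
  have key := eq_zero_of_transport_bdrySlab hT (G := fun y => F (bdryL n y) ⬝ᵥ normalN T φ y)
    (b := fun z => -(∑ j, dx (bdrySlab n T) j (fun y => β y j) z)) hM
    (ContDiffOn.differentiableOn (n := 1) (ContDiffOn.sum fun i _ =>
      ((hF i).comp (bdryL n).contDiff.contDiffOn mapsTo_bdryL).mul (contDiffOn_normalN hT hφ i))
      (by norm_num))
    (continuousOn_finsetSum _ fun j _ => ((hβ j).continuousOn_fderivWithin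
      (uniqueDiffOn_bdrySlab hT) (by norm_num)).clm_apply continuousOn_const).neg hβM
    (fun z hz => transport_normal hT hχ hφ hs hF hΨ hβ hνN hanti htan hz
      (heq _ (mapsTo_bdryL hz)))
    (fun x => by rw [bdryL_apply]; exact h0 x) (t, x) ⟨ht, mem_univ _⟩
  rwa [bdryL_apply] at key

end Boundary

/-! ### The quasilinear operator written with lifted derivatives -/

section Operator

/-- The quasilinear operator in terms of the lifted derivatives. -/
theorem opL_eq {n : ℕ} {ι : Type} [Fintype ι] [DecidableEq ι] {D : Set (ℝ × (Fin (n + 1) → ℝ))}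
    {c : ℝ} {A : ℝ × (Fin (n + 1) → ℝ) → Fin (n + 1) → Matrix ι ι ℝ}
    {Φ : ℝ × (Fin (n + 1) → ℝ) → ℝ} {W : ℝ × (Fin (n + 1) → ℝ) → ι → ℝ}
    {z : ℝ × (Fin (n + 1) → ℝ)} (hD : UniqueDiffWithinAt ℝ D z)
    (hW : DifferentiableWithinAt ℝ W D z) (hne : fderivWithin ℝ Φ D z (dirX 0) ≠ 0) :
    opL D c A Φ W z = (c • fun k => dtL D Φ (fun y => W y k) z)
      + ∑ i, A z i *ᵥ fun k => dxL D Φ i (fun y => W y k) z := by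
  have hcomp : ∀ v k, fderivWithin ℝ W D z v k = fderivWithin ℝ (fun y => W y k) D z v := by
    intro v k
    rw [fderivWithin_pi (fun k => differentiableWithinAt_pi.1 hW k) hD]
    rfl
  have hne' : dx D 0 Φ z ≠ 0 := hne
  have ht : (fun k => dtL D Φ (fun y => W y k) z)
      = dt D W z - (dt D Φ z / dx D 0 Φ z) • dx D 0 W z := by
    funext k
    simp only [dtL, pd, ← hcomp, Pi.sub_apply, Pi.smul_apply, smul_eq_mul]
    simp only [dt, dx, dirT, dirX]
    ring
  have h0 : (fun k => dxL D Φ 0 (fun y => W y k) z) = (dx D 0 Φ z)⁻¹ • dx D 0 W z := by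
    funext k
    simp only [dxL, pd, ← hcomp, Pi.smul_apply, smul_eq_mul, if_true]
    change dx D 0 W z k + (1 - dx D 0 Φ z) / dx D 0 Φ z * dx D 0 W z k = _
    field_simp
    ring
  have hs : ∀ j : Fin n, (fun k => dxL D Φ j.succ (fun y => W y k) z)
      = dx D j.succ W z - ((dx D 0 Φ z)⁻¹ * dx D j.succ Φ z) • dx D 0 W z := by
    intro j
    funext k
    simp only [dxL, pd, ← hcomp, Pi.sub_apply, Pi.smul_apply, smul_eq_mul, Fin.succ_ne_zero,
      if_false]
    simp only [dx, dirX]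
    ring
  rw [Fin.sum_univ_succ, ht, h0]
  simp only [hs, opL, Matrix.smul_mulVec, Matrix.sub_mulVec, Matrix.add_mulVec, Matrix.sum_mulVec,
    Matrix.one_mulVec, Matrix.mulVec_sub, Matrix.mulVec_smul, Finset.sum_sub_distrib, smul_sub,
    smul_add, Finset.smul_sum, smul_smul]
  rw [show (dx D 0 Φ z)⁻¹ * -(c * dt D Φ z) = -(c * (dt D Φ z / dx D 0 Φ z)) by ring]
  rw [neg_smul]
  abel

end Operator

/-! ### Invertibility of the plasma matrices and the induction equation -/

section PlasmaAlgebra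

variable {d : ℕ}

theorem blockMat_mulVec_q (a : ℝ) (r₂ r₃ c₂ : Fin d → ℝ) (M₂₂ M₂₃ M₃₂ M₃₃ : Matrix (Fin d) (Fin d) ℝ)
    (s : ℝ) (X : PIdx d → ℝ) :
    qC (blockMat a r₂ r₃ c₂ M₂₂ M₂₃ M₃₂ M₃₃ s *ᵥ X) = a * qC X + r₂ ⬝ᵥ vC X + r₃ ⬝ᵥ HC X := by
  simp [blockMat, Matrix.mulVec, dotProduct, qC, vC, HC, Fintype.sum_sum_type, add_assoc]

theorem blockMat_mulVec_v (a : ℝ) (r₂ r₃ c₂ : Fin d → ℝ) (M₂₂ M₂₃ M₃₂ M₃₃ : Matrix (Fin d) (Fin d) ℝ)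
    (s : ℝ) (X : PIdx d → ℝ) :
    vC (blockMat a r₂ r₃ c₂ M₂₂ M₂₃ M₃₂ M₃₃ s *ᵥ X)
      = qC X • c₂ + M₂₂ *ᵥ vC X + M₂₃ *ᵥ HC X := by
  funext i
  simp [blockMat, Matrix.mulVec, dotProduct, qC, vC, HC, Fintype.sum_sum_type, add_assoc,
    mul_comm]

theorem blockMat_mulVec_H (a : ℝ) (r₂ r₃ c₂ : Fin d → ℝ) (M₂₂ M₂₃ M₃₂ M₃₃ : Matrix (Fin d) (Fin d) ℝ)
    (s : ℝ) (X : PIdx d → ℝ) :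
    HC (blockMat a r₂ r₃ c₂ M₂₂ M₂₃ M₃₂ M₃₃ s *ᵥ X) = M₃₂ *ᵥ vC X + M₃₃ *ᵥ HC X := by
  funext i
  simp [blockMat, Matrix.mulVec, dotProduct, vC, HC, Fintype.sum_sum_type]

theorem blockMat_mulVec_s (a : ℝ) (r₂ r₃ c₂ : Fin d → ℝ) (M₂₂ M₂₃ M₃₂ M₃₃ : Matrix (Fin d) (Fin d) ℝ)
    (s : ℝ) (X : PIdx d → ℝ) :
    sC (blockMat a r₂ r₃ c₂ M₂₂ M₂₃ M₃₂ M₃₃ s *ᵥ X) = s * sC X := by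
  simp [blockMat, Matrix.mulVec, dotProduct, sC, Fintype.sum_sum_type]

theorem eq_zero_of_components {X : PIdx d → ℝ} (hq : qC X = 0) (hv : vC X = 0) (hH : HC X = 0)
    (hs : sC X = 0) : X = 0 := by
  funext i
  rcases i with i | i | i | i
  · rw [Subsingleton.elim i 0]; exact hq
  · exact congrFun hv i
  · exact congrFun hH i
  · rw [Subsingleton.elim i 0]; exact hs

theorem tens_mulVec (u w x : Fin d → ℝ) : tens u w *ᵥ x = (w ⬝ᵥ x) • u := by
  funext i
  simp only [tens, Matrix.mulVec, Matrix.vecMulVec, dotProduct, Matrix.of_apply, Pi.smul_apply,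
    smul_eq_mul, Finset.sum_mul]
  exact Finset.sum_congr rfl fun j _ => by ring

variable {ε : ℝ} {U : PIdx d → ℝ}

theorem speed_lt {w : Fin d → ℝ} (hε : 0 < ε) (h : eucl w < ε⁻¹) : ε ^ 2 * (w ⬝ᵥ w) < 1 := by
  have h0 : 0 ≤ w ⬝ᵥ w := Finset.sum_nonneg fun i _ => mul_self_nonneg _
  have h1 : w ⬝ᵥ w < ε⁻¹ ^ 2 := (Real.sqrt_lt' (by positivity)).1 h
  calc ε ^ 2 * (w ⬝ᵥ w) < ε ^ 2 * ε⁻¹ ^ 2 := by gcongr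
    _ = 1 := by field_simp

theorem abs_le_eucl (w : Fin d → ℝ) (i : Fin d) : |w i| ≤ eucl w := by
  rw [← Real.sqrt_sq_eq_abs]
  refine Real.sqrt_le_sqrt ?_
  rw [sq]
  exact Finset.single_le_sum (f := fun i => w i * w i) (fun i _ => mul_self_nonneg _)
    (Finset.mem_univ i)

theorem lorentz_pos (h : ε ^ 2 * (vC U ⬝ᵥ vC U) < 1) : 0 < lorentz ε U :=
  one_div_pos.2 (Real.sqrt_pos.2 (by linarith))

theorem lorentz_sq (h : ε ^ 2 * (vC U ⬝ᵥ vC U) < 1) :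
    lorentz ε U ^ 2 * (1 - ε ^ 2 * (vC U ⬝ᵥ vC U)) = 1 := by
  have h0 : (0 : ℝ) < 1 - ε ^ 2 * (vC U ⬝ᵥ vC U) := by linarith
  rw [lorentz, div_pow, Real.sq_sqrt h0.le]
  field_simp

theorem M0_mulVec (x : Fin d → ℝ) : M0 ε U *ᵥ x
    = (lorentz ε U)⁻¹ • (x + (ε ^ 2 * lorentz ε U ^ 2 * (vC U ⬝ᵥ x)) • vC U) := by
  simp only [M0, Matrix.smul_mulVec, Matrix.add_mulVec, Matrix.one_mulVec, tens_mulVec, smul_smul]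

/-- Pairing `𝓜₀ x = 0` with `v` gives `(v·x)(1 + ε²Γ²|v|²) = 0`, so `v·x = 0` and then `x = 0`. -/
theorem M0_injective (h : ε ^ 2 * (vC U ⬝ᵥ vC U) < 1) {x : Fin d → ℝ} (hx : M0 ε U *ᵥ x = 0) :
    x = 0 := by
  have hΓ := lorentz_pos h
  rw [M0_mulVec, smul_eq_zero_iff_right (inv_ne_zero hΓ.ne')] at hx
  have h0 : 0 ≤ vC U ⬝ᵥ vC U := Finset.sum_nonneg fun i _ => mul_self_nonneg _
  have h1 := congrArg (fun y => vC U ⬝ᵥ y) hx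
  simp only [dotProduct_add, dotProduct_smul, smul_eq_mul, dotProduct_zero] at h1
  have h2 : (vC U ⬝ᵥ x) * (1 + ε ^ 2 * lorentz ε U ^ 2 * (vC U ⬝ᵥ vC U)) = 0 := by linarith
  have h3 : vC U ⬝ᵥ x = 0 := (mul_eq_zero.1 h2).resolve_right (by positivity)
  simpa [h3] using hx

theorem isUnit_of_mulVec {ι : Type*} [Fintype ι] [DecidableEq ι] {A : Matrix ι ι ℝ}
    (h : ∀ x, A *ᵥ x = 0 → x = 0) : IsUnit A.det := by
  rw [← Matrix.isUnit_iff_isUnit_det, ← Matrix.mulVec_injective_iff_isUnit]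
  intro x y hxy
  have := h (x - y) (by rw [Matrix.mulVec_sub]; exact sub_eq_zero.2 hxy)
  exact sub_eq_zero.1 this

/-- `J` is block triangular with invertible diagonal blocks `1`, `Γ²𝓜₀`, `I`, `1`. Invertibility
must be proved, as the inverse of a singular matrix is `0` by convention. -/
theorem isUnit_det_Jmat (h : ε ^ 2 * (vC U ⬝ᵥ vC U) < 1) : IsUnit (Jmat ε U).det := by
  refine isUnit_of_mulVec fun x hx => ?_
  have hΓ := lorentz_pos h
  have h1 := congrArg qC hx
  have h2 := congrArg vC hx
  have h3 := congrArg HC hx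
  have h4 := congrArg sC hx
  simp only [Jmat, blockMat_mulVec_q, blockMat_mulVec_v, blockMat_mulVec_H, blockMat_mulVec_s]
    at h1 h2 h3 h4
  have hH : HC x = 0 := by simpa [HC, funext_iff] using h3
  have hv : vC x = 0 := by
    have : lorentz ε U ^ 2 • (M0 ε U *ᵥ vC x) = 0 := by
      simpa [Matrix.smul_mulVec, vC, funext_iff, hΓ.ne'] using h2
    exact M0_injective h ((smul_eq_zero_iff_right (by positivity)).1 this)
  refine eq_zero_of_components ?_ hv hH ?_
  · simpa [hv, hH, qC] using h1
  · simpa [sC] using h4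

theorem dotProduct_sq_le (x y : Fin d → ℝ) : (x ⬝ᵥ y) ^ 2 ≤ (x ⬝ᵥ x) * (y ⬝ᵥ y) := by
  simpa [dotProduct, sq] using Finset.sum_mul_sq_le_sq_mul_sq Finset.univ x y

/-- `B₀` splits into `𝓜₀`, `1` and the block in `(q, w)`, where `w = vC x`. In the latter the first
row eliminates `q`, and pairing the second with `w` leaves a sum of three nonnegative terms, one of
which controls `w`. -/
theorem isUnit_det_B0 {c : Constitutive} (hc : c.Admissible ε) (hε : 0 < ε)
    (h : ε ^ 2 * (vC U ⬝ᵥ vC U) < 1) (hU : c.Hyperbolic (thermo ε U)) :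
    IsUnit (B0 ε U c).det := by
  refine isUnit_of_mulVec fun x hx => ?_
  have hΓ := lorentz_pos h
  have hΓ2 := lorentz_sq h
  have hρ := hc.dens_pos _ hU.1
  have ha := hc.aSq_pos _ hU
  have hcs := hc.soundSpeed_pos _ hU
  have hcs' := hc.soundSpeed_lt _ hU
  -- Positivity of `𝔣` is not among the assumptions. It follows from `c_s > 0`, because `Real.sqrt`
  -- vanishes on nonpositive numbers, and from `a² > 0`.
  have hf : 0 < c.index ε (thermo ε U) := by
    have := Real.sqrt_pos.1 hcs
    exact inv_pos.1 (pos_of_mul_pos_left this ha.le)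
  -- The square of `c_s < ε⁻¹`.
  have hfa : ε ^ 2 * c.aSq (thermo ε U) < c.index ε (thermo ε U) := by
    have h1 := (Real.sqrt_lt' (by positivity)).1 hcs'
    rw [inv_mul_eq_div, div_lt_iff₀ hf, inv_pow, inv_mul_eq_div, lt_div_iff₀ (by positivity)] at h1
    linarith
  have h1 := congrArg qC hx
  have h2 := congrArg vC hx
  have h3 := congrArg HC hx
  have h4 := congrArg sC hx
  simp only [B0, blockMat_mulVec_q, blockMat_mulVec_v, blockMat_mulVec_H, blockMat_mulVec_s]
    at h1 h2 h3 h4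
  have hH : HC x = 0 := M0_injective h (by simpa [HC, funext_iff] using h3)
  have hS : sC x = 0 := by simpa [sC] using h4
  have h5 := congrArg (fun y => vC x ⬝ᵥ y) h2
  have hz : vC (0 : PIdx d → ℝ) = 0 := rfl
  have hzq : qC (0 : PIdx d → ℝ) = 0 := rfl
  simp only [A0, hz, Matrix.zero_mulVec, add_zero, Matrix.smul_mulVec, Matrix.add_mulVec,
    Matrix.sub_mulVec, Matrix.one_mulVec, tens_mulVec, dotProduct_add, dotProduct_sub,
    dotProduct_smul, smul_eq_mul, dotProduct_zero] at h5
  simp only [hzq, smul_dotProduct, zero_dotProduct, smul_eq_mul, add_zero] at h1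
  rw [dotProduct_comm (vC x) (vC U), dotProduct_comm (vC x) (HC U)] at h5
  -- Cauchy–Schwarz for `H` against `w - ε²(v·w)v`, whose inner product with `H` is `H·w -
  -- ε²(v·w)(v·H)`, the combination occurring in `hkey`.
  have hCS := dotProduct_sq_le (HC U) (vC x - (ε ^ 2 * (vC U ⬝ᵥ vC x)) • vC U)
  have hw0 : 0 ≤ (vC x - (ε ^ 2 * (vC U ⬝ᵥ vC x)) • vC U)
      ⬝ᵥ (vC x - (ε ^ 2 * (vC U ⬝ᵥ vC x)) • vC U) :=
    Finset.sum_nonneg fun i _ => mul_self_nonneg _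
  have hw : (vC x - (ε ^ 2 * (vC U ⬝ᵥ vC x)) • vC U)
      ⬝ᵥ (vC x - (ε ^ 2 * (vC U ⬝ᵥ vC x)) • vC U) = 0 → vC x = 0 := by
    intro h0
    have e : vC x - (ε ^ 2 * (vC U ⬝ᵥ vC x)) • vC U = 0 := dotProduct_self_eq_zero.1 h0
    have e1 := congrArg (fun y => vC U ⬝ᵥ y) e
    simp only [dotProduct_sub, dotProduct_smul, smul_eq_mul, dotProduct_zero] at e1
    have e2 : (vC U ⬝ᵥ vC x) * (1 - ε ^ 2 * (vC U ⬝ᵥ vC U)) = 0 := by linarith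
    have e3 : vC U ⬝ᵥ vC x = 0 := (mul_eq_zero.1 e2).resolve_right (by linarith)
    simpa [e3] using e
  set w' := (vC x - (ε ^ 2 * (vC U ⬝ᵥ vC x)) • vC U)
      ⬝ᵥ (vC x - (ε ^ 2 * (vC U ⬝ᵥ vC x)) • vC U) with hw'
  have hw'e : w' = vC x ⬝ᵥ vC x - 2 * ε ^ 2 * (vC U ⬝ᵥ vC x) ^ 2
      + ε ^ 4 * (vC U ⬝ᵥ vC x) ^ 2 * (vC U ⬝ᵥ vC U) := by
    rw [hw']
    simp only [dotProduct_sub, sub_dotProduct, dotProduct_smul, smul_dotProduct, smul_eq_mul,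
      dotProduct_comm (vC x) (vC U)]
    ring
  simp only [dotProduct_sub, dotProduct_smul, smul_eq_mul, dotProduct_comm (HC U) (vC U)] at hCS
  simp only [inertia, bSq] at h5
  set Γ := lorentz ε U
  set ρ := c.dens (thermo ε U)
  set f := c.index ε (thermo ε U)
  set a := c.aSq (thermo ε U)
  set q := qC x
  set vw := vC U ⬝ᵥ vC x
  set ww := vC x ⬝ᵥ vC x
  set vv := vC U ⬝ᵥ vC U
  set HH := HC U ⬝ᵥ HC U
  set vH := vC U ⬝ᵥ HC U
  set Hw := HC U ⬝ᵥ vC x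
  have hq : q = -(ε ^ 2 * vw) * (ρ * a) / Γ := by
    field_simp
    field_simp at h1
    linarith
  have hΓi : 1 / Γ ^ 2 = 1 - ε ^ 2 * vv := by
    rw [div_eq_iff (by positivity)]; linarith
  -- The quadratic form of the `(q, w)` block after eliminating `q`. The second term is nonnegative
  -- because sound is slower than light, the third by Cauchy–Schwarz; hence `w' = 0`.
  have hkey : ρ * f * Γ * w' + ρ * ε ^ 2 / Γ * vw ^ 2 * (f - ε ^ 2 * a)
      + ε ^ 2 / Γ * (HH * w' - (Hw - ε ^ 2 * vw * vH) ^ 2) = 0 := by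
    rw [div_eq_mul_one_div HH, hΓi, hq] at h5
    have e : ρ * ε ^ 2 / Γ * vw ^ 2 * f = ρ * ε ^ 2 * vw ^ 2 * f * Γ * (1 - ε ^ 2 * vv) := by
      rw [← hΓi]; field_simp
    have e2 : ρ * ε ^ 2 / Γ * vw ^ 2 * (f - ε ^ 2 * a) = ρ * ε ^ 2 / Γ * vw ^ 2 * f
      - ρ * ε ^ 4 / Γ * vw ^ 2 * a := by ring
    rw [e2, e, hw'e]
    rw [← h5]
    ring
  have hpos1 : 0 ≤ ρ * ε ^ 2 / Γ * vw ^ 2 * (f - ε ^ 2 * a) :=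
    mul_nonneg (by positivity) (by linarith)
  have hpos2 : 0 ≤ ε ^ 2 / Γ * (HH * w' - (Hw - ε ^ 2 * vw * vH) ^ 2) :=
    mul_nonneg (by positivity) (by linarith)
  have hpos3 : 0 < ρ * f * Γ := by positivity
  have hw0' : w' = 0 := by
    by_contra hne
    have : 0 < ρ * f * Γ * w' := mul_pos hpos3 (lt_of_le_of_ne hw0 (Ne.symm hne))
    linarith
  have hv := hw hw0'
  refine eq_zero_of_components ?_ hv hH hS
  change q = 0
  have : vw = 0 := by simp [vw, hv]
  rw [hq, this]; simp

/-- The coupling block in the variables `U` is `𝓜₀` times the stretching term of the induction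
equation, so `𝓜₀` factors out of the `H` rows. The only input is `ε²|v|²Γ² = Γ² - 1`. -/
theorem Nj_mulVec (h : ε ^ 2 * (vC U ⬝ᵥ vC U) < 1) (j : Fin d) (x : Fin d → ℝ) :
    Nj ε U j *ᵥ ((lorentz ε U ^ 2 • M0 ε U) *ᵥ x) = M0 ε U *ᵥ (x j • HC U - HC U j • x) := by
  have hΓ := lorentz_pos h
  have hΓ2 := lorentz_sq h
  have hu : ∀ y : Fin d → ℝ, unitVec j ⬝ᵥ y = y j := fun y => by simp [unitVec]
  rw [Matrix.smul_mulVec, M0_mulVec, M0_mulVec]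
  simp only [Nj, Matrix.sub_mulVec, Matrix.smul_mulVec, tens_mulVec, Matrix.one_mulVec,
    sub_dotProduct, smul_dotProduct, dotProduct_smul, dotProduct_add, dotProduct_sub, smul_eq_mul,
    hu]
  funext k
  simp only [Pi.sub_apply, Pi.add_apply, Pi.smul_apply, smul_eq_mul]
  set Γ := lorentz ε U
  set vv := vC U ⬝ᵥ vC U
  set vx := vC U ⬝ᵥ x
  have hΓi : ε ^ 2 * vv * Γ ^ 2 = Γ ^ 2 - 1 := by linarith
  field_simp
  linear_combination (-(HC U k + ε ^ 2 * Γ ^ 2 * (vC U ⬝ᵥ HC U) * vC U k)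
    * ε ^ 2 * vC U j * vx) * hΓi

/-- The induction equation contained in the symmetrized plasma system. -/
theorem induction_of_plasma {c : Constitutive} (hc : c.Admissible ε) (hε : 0 < ε)
    (h : ε ^ 2 * (vC U ⬝ᵥ vC U) < 1) (hU : c.Hyperbolic (thermo ε U))
    {Y : PIdx d → ℝ} {X : Fin d → PIdx d → ℝ} (heq : Y + ∑ i, Aplus ε U c i *ᵥ X i = 0) :
    HC Y + ∑ i, (vC (X i) i • HC U - HC U i • vC (X i) + vC U i • HC (X i)) = 0 := by
  have hJ := isUnit_det_Jmat h
  have hB := isUnit_det_B0 hc hε h hU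
  -- Multiplication by `B₀ J` removes the inverses and returns to the symmetric system, whose `H`
  -- rows are explicit.
  have h1 : ∀ i, (B0 ε U c * Jmat ε U) * Aplus ε U c i = Bj ε U c i * Jmat ε U := by
    intro i
    simp only [Aplus, Matrix.mul_assoc]
    rw [Matrix.mul_nonsing_inv_cancel_left _ _ hJ, Matrix.mul_nonsing_inv_cancel_left _ _ hB]
  have h2 := congrArg (fun y => (B0 ε U c * Jmat ε U) *ᵥ y) heq
  simp only [Matrix.mulVec_add, Matrix.mulVec_sum, Matrix.mulVec_mulVec, h1, Matrix.mulVec_zero]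
    at h2
  have h3 := congrArg HC h2
  have hadd : ∀ a b : PIdx d → ℝ, HC (a + b) = HC a + HC b := fun _ _ => rfl
  have hsum : ∀ a : Fin d → PIdx d → ℝ, HC (∑ i, a i) = ∑ i, HC (a i) := fun a => by
    funext k; simp [HC]
  simp only [← Matrix.mulVec_mulVec] at h3
  rw [hadd, hsum] at h3
  have hJv : ∀ y, vC (Jmat ε U *ᵥ y) = (lorentz ε U ^ 2 • M0 ε U) *ᵥ vC y := fun y => by
    rw [Jmat, blockMat_mulVec_v]; simp
  have hJH : ∀ y, HC (Jmat ε U *ᵥ y) = HC y := fun y => by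
    rw [Jmat, blockMat_mulVec_H]; simp
  have hz : HC (0 : PIdx d → ℝ) = 0 := rfl
  simp only [B0, Bj, blockMat_mulVec_H, hJv, hJH, Nj_mulVec h, hz, Matrix.zero_mulVec, zero_add]
    at h3
  simp only [Matrix.smul_mulVec] at h3
  simp only [← Matrix.mulVec_smul, ← Matrix.mulVec_add, ← Matrix.mulVec_sum] at h3
  exact M0_injective h h3

end PlasmaAlgebra

theorem pd_const_mul {E : Type*} [NormedAddCommGroup E] [NormedSpace ℝ E] {S : Set E} {f g : E → ℝ}
    {z : E} (hS : UniqueDiffOn ℝ S) (hz : z ∈ S) (h : DifferentiableWithinAt ℝ f S z)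
    (e a : E) (κ r : ℝ) : pd S g e a κ (fun y => r * f y) z = r * pd S g e a κ f z := by
  rw [pd_mul hS hz (differentiableWithinAt_const r) h]
  simp [pd]

/-! ### Extension of the evolution equation to the boundary -/

section Conservation

variable {n : ℕ} {T : ℝ} {χ : ℝ → ℝ} {φ : ℝ × (Fin n → ℝ) → ℝ} {s : ℝ}

/-- The equation for `F` extends from `[0,T] × Ω` to its closure. -/
theorem conservation_on_slab (hT : 0 < T) (hχ : IsCutoff χ)
    (hφ : ContDiffOn ℝ 2 φ (bdrySlab n T)) (hφle : ∀ z ∈ bdrySlab n T, |φ z| ≤ 2)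
    (hs : s * s = 1) {F ν : ℝ × (Fin (n + 1) → ℝ) → Fin (n + 1) → ℝ}
    {Ψ : Fin (n + 1) → Fin (n + 1) → ℝ × (Fin (n + 1) → ℝ) → ℝ}
    (hF : ∀ i, ContDiffOn ℝ 2 (fun z => F z i) (slab n T))
    (hΨ : ∀ i j, ContDiffOn ℝ 2 (Ψ i j) (slab n T))
    (hν : ∀ i, ContDiffOn ℝ 1 (fun z => ν z i) (slab n T))
    (heq : ∀ t ∈ Icc 0 T, ∀ x ∈ halfSpace n, ∀ i,
      dtL (slab n T) (lift χ φ s) (fun y => F y i) (t, x)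
      + ∑ j, dxL (slab n T) (lift χ φ s) j (Ψ j i) (t, x)
      + (∑ j, dxL (slab n T) (lift χ φ s) j (fun y => F y j) (t, x)) * ν (t, x) i = 0) :
    ∀ z ∈ slab n T, ∀ i, dtL (slab n T) (lift χ φ s) (fun y => F y i) z
      + ∑ j, dxL (slab n T) (lift χ φ s) j (Ψ j i) z
      + (∑ j, dxL (slab n T) (lift χ φ s) j (fun y => F y j) z) * ν z i = 0 := by
  intro z hz i
  have hc : ∀ {f : ℝ × (Fin (n + 1) → ℝ) → ℝ}, ContDiffOn ℝ 2 f (slab n T) → ∀ a κ,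
      ContinuousOn (pd (slab n T) (lift χ φ s) (dirX 0) a κ f) (slab n T) := fun hf a κ =>
    (contDiffOn_pd (uniqueDiffOn_slab hT) hf (contDiffOn_lift hχ hφ s)
      (fderivWithin_lift_ne_zero hT hχ hφ hφle hs) a κ).continuousOn
  exact eqOn_slab_of_halfSpace hT (((hc (hF i) _ _).add
    (continuousOn_finsetSum _ fun j _ => hc (hΨ j i) _ _)).add
    ((continuousOn_finsetSum _ fun j _ => hc (hF j) _ _).mul (hν i).continuousOn))
    continuousOn_const (fun t ht x hx => heq t ht x hx i) hz

end Conservation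

/-! ### Conservative equations and constraints of a solution -/

section Solution

variable {n m l : ℕ} {ε T : ℝ} {c : Constitutive} {χ : ℝ → ℝ}
  {Am : (Fin (n + 1) → ℝ) → Fin (n + 1) → Matrix (Fin m) (Fin m) ℝ}
  {B : (PIdx (n + 1) → ℝ) → (Fin m → ℝ) → ℝ → (Fin n → ℝ) → Fin l → ℝ}
  {U : ℝ × (Fin (n + 1) → ℝ) → PIdx (n + 1) → ℝ} {u : ℝ × (Fin (n + 1) → ℝ) → Fin m → ℝ}
  {φ : ℝ × (Fin n → ℝ) → ℝ} {ν : ℝ × (Fin (n + 1) → ℝ) → Fin (n + 1) → ℝ}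
  {U₀ : (Fin (n + 1) → ℝ) → PIdx (n + 1) → ℝ} {u₀ : (Fin (n + 1) → ℝ) → Fin m → ℝ}
  {φ₀ : (Fin n → ℝ) → ℝ}

/-- The strict speed limit is given only in `Ω`; its limit on `Σ` need not be strict, but a bound is
all that transport requires. -/
theorem IsSolution.abs_v_le (hT : 0 < T) (sol : IsSolution ε T c χ Am B U u φ ν U₀ u₀ φ₀) :
    ∀ z ∈ slab n T, ∀ i, |vC (U z) i| ≤ ε⁻¹ := fun z hz i =>
  le_on_slab_of_halfSpace hT (continuousOn_pi.1 sol.smooth_U.continuousOn _).abs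
    (fun t ht x hx => (abs_le_eucl _ i).trans (sol.v_lt t ht x hx).le) z hz

theorem IsSolution.abs_ν_le (hT : 0 < T) (sol : IsSolution ε T c χ Am B U u φ ν U₀ u₀ φ₀) :
    ∀ z ∈ slab n T, ∀ i, |ν z i| ≤ ε⁻¹ := fun z hz i =>
  le_on_slab_of_halfSpace hT (continuousOn_pi.1 sol.smooth_ν.continuousOn i).abs
    (fun t ht x hx => (abs_le_eucl _ i).trans (sol.ν_lt t ht x hx).le) z hz

/-- The induction equation in conservative form. -/
theorem IsSolution.induction (hε : 0 < ε) (hT : 0 < T) (hc : c.Admissible ε) (hχ : IsCutoff χ)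
    (sol : IsSolution ε T c χ Am B U u φ ν U₀ u₀ φ₀) :
    ∀ z ∈ slab n T, ∀ i, dtL (slab n T) (lift χ φ 1) (fun y => HC (U y) i) z
      + ∑ j, dxL (slab n T) (lift χ φ 1) j
        (fun y => vC (U y) j * HC (U y) i - HC (U y) j * vC (U y) i) z
      + (∑ j, dxL (slab n T) (lift χ φ 1) j (fun y => HC (U y) j) z) * vC (U z) i = 0 := by
  have hU := contDiffOn_pi.1 sol.smooth_U
  have hv : ∀ i, ContDiffOn ℝ 2 (fun z => vC (U z) i) (slab n T) := fun i => hU _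
  have hH : ∀ i, ContDiffOn ℝ 2 (fun z => HC (U z) i) (slab n T) := fun i => hU _
  refine conservation_on_slab hT hχ sol.smooth_φ sol.φ_le (one_mul 1) (F := fun z => HC (U z))
    (ν := fun z => vC (U z))
    (Ψ := fun j i y => vC (U y) j * HC (U y) i - HC (U y) j * vC (U y) i) hH
    (fun i j => ((hv i).mul (hH j)).sub ((hH i).mul (hv j)))
    (fun i => (hv i).of_le (by norm_num)) ?_
  intro t ht x hx i
  have hz : (t, x) ∈ slab n T := ⟨ht, halfSpace_subset_closedHalfSpace hx⟩
  have hS := uniqueDiffOn_slab (n := n) hT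
  have h1 := sol.plasma t ht x hx
  rw [opL_eq (hS _ hz) (sol.smooth_U.differentiableOn (by norm_num) _ hz)
    (fderivWithin_lift_ne_zero hT hχ sol.smooth_φ sol.φ_le (one_mul 1) _ hz), one_smul] at h1
  -- The inversion of `J` and `B₀` takes place at a point of `Ω`, where `|v| < ε⁻¹` and
  -- hyperbolicity are strict; only the resulting equation is extended to `Σ` by continuity.
  have h2 := congrFun (induction_of_plasma hc hε (speed_lt hε (sol.v_lt t ht x hx))
    (sol.hyperbolic t ht x hx) h1) i
  have dv : ∀ i, DifferentiableWithinAt ℝ (fun z => vC (U z) i) (slab n T) (t, x) := fun i =>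
    (hv i).differentiableOn (by norm_num) _ hz
  have dH : ∀ i, DifferentiableWithinAt ℝ (fun z => HC (U z) i) (slab n T) (t, x) := fun i =>
    (hH i).differentiableOn (by norm_num) _ hz
  -- The term `-(∂ⱼHⱼ) vᵢ` of this expansion is what `(∇^Φ·H) v` compensates, so the conservative
  -- form holds without assuming `∇^Φ·H = 0`.
  have h3 : ∀ j, dxL (slab n T) (lift χ φ 1) j
      (fun y => vC (U y) j * HC (U y) i - HC (U y) j * vC (U y) i) (t, x)
      = vC (U (t, x)) j * dxL (slab n T) (lift χ φ 1) j (fun y => HC (U y) i) (t, x)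
        + dxL (slab n T) (lift χ φ 1) j (fun y => vC (U y) j) (t, x) * HC (U (t, x)) i
        - (HC (U (t, x)) j * dxL (slab n T) (lift χ φ 1) j (fun y => vC (U y) i) (t, x)
        + dxL (slab n T) (lift χ φ 1) j (fun y => HC (U y) j) (t, x) * vC (U (t, x)) i) := by
    intro j
    simp only [sub_eq_add_neg, dxL]
    rw [pd_add hS hz ((dv j).fun_mul (dH i)) ((dH j).fun_mul (dv i)).fun_neg, pd_neg hS hz,
      pd_mul hS hz (dv j) (dH i), pd_mul hS hz (dH j) (dv i)]
  simp only [h3, Finset.sum_mul]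
  simp only [Pi.add_apply, Finset.sum_apply, Pi.sub_apply, Pi.smul_apply, smul_eq_mul,
    Pi.zero_apply] at h2
  rw [add_assoc, ← Finset.sum_add_distrib, ← h2]
  congr 1
  refine Finset.sum_congr rfl fun j _ => ?_
  simp only [vC, HC]
  ring

/-- The constraints on the magnetic field of the plasma. -/
theorem IsSolution.preserved_plasma (hε : 0 < ε) (hT : 0 < T) (hc : c.Admissible ε)
    (hχ : IsCutoff χ) (sol : IsSolution ε T c χ Am B U u φ ν U₀ u₀ φ₀)
    (hkin : ∀ z ∈ bdrySlab n T, dt (bdrySlab n T) φ z = vC (U (bdryL n z)) ⬝ᵥ normalN T φ z) :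
    Preserved T (DivFreeAt T (lift χ φ 1) fun z => HC (U z)) ∧
      Preserved T (TangentAt T φ fun z => HC (U z)) := by
  have hU := contDiffOn_pi.1 sol.smooth_U
  have hv : ∀ i, ContDiffOn ℝ 2 (fun z => vC (U z) i) (slab n T) := fun i => hU _
  have hH : ∀ i, ContDiffOn ℝ 2 (fun z => HC (U z) i) (slab n T) := fun i => hU _
  have hΨ : ∀ j i, ContDiffOn ℝ 2 (fun y => vC (U y) j * HC (U y) i - HC (U y) j * vC (U y) i)
      (slab n T) := fun i j => ((hv i).mul (hH j)).sub ((hH i).mul (hv j))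
  have heq := sol.induction hε hT hc hχ
  refine ⟨preserved_divFreeAt hT hχ sol.smooth_φ sol.φ_le (one_mul 1) hH hΨ
    (fun i => (hv i).of_le (by norm_num)) (sol.abs_v_le hT) hkin (fun i j z => by ring) heq,
    preserved_tangentAt hT hχ sol.smooth_φ (one_mul 1) (inv_pos.2 hε).le
      (β := fun z j => vC (U (bdryL n z)) j.succ)
      (fun i => (hH i).of_le (by norm_num)) (fun i j => (hΨ i j).of_le (by norm_num))
      (fun j => ((hv j.succ).of_le (by norm_num)).comp (bdryL n).contDiff.contDiffOn mapsTo_bdryL)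
      (fun z hz j => sol.abs_v_le hT _ (mapsTo_bdryL hz) _) hkin (fun i j z => by ring) ?_ heq⟩
  -- `(Ψ N)ⱼ = vⱼ (H·N) - Hⱼ (v·N)` and `v·N = ∂ₜφ`, so `β` is the tangential velocity.
  intro z hz j
  rw [hkin z hz]
  simp only [dotProduct, Finset.mul_sum]
  rw [← Finset.sum_sub_distrib]
  exact Finset.sum_congr rfl fun i _ => by ring

/-- The vacuum equations in terms of the lifted derivatives. -/
theorem IsSolution.vacuum_eq (hT : 0 < T) (hχ : IsCutoff χ)
    (sol : IsSolution ε T c χ Am B U u φ ν U₀ u₀ φ₀) {t : ℝ} (ht : t ∈ Icc 0 T)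
    {x : Fin (n + 1) → ℝ} (hx : x ∈ halfSpace n) (k : Fin m) :
    ε * dtL (slab n T) (lift χ φ (-1)) (fun y => u y k) (t, x)
      + ∑ i, ∑ r, Am (ν (t, x)) i k r * dxL (slab n T) (lift χ φ (-1)) i (fun y => u y r) (t, x)
      = 0 := by
  have hz : (t, x) ∈ slab n T := ⟨ht, halfSpace_subset_closedHalfSpace hx⟩
  have h1 := sol.vacuum t ht x hx
  rw [opL_eq (uniqueDiffOn_slab hT _ hz) (sol.smooth_u.differentiableOn (by norm_num) _ hz)
    (fderivWithin_lift_ne_zero hT hχ sol.smooth_φ sol.φ_le (by norm_num) _ hz)] at h1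
  have h2 := congrFun h1 k
  simpa [Matrix.mulVec, dotProduct] using h2

theorem IsSolution.kinematic_ν (sol : IsSolution ε T c χ Am B U u φ ν U₀ u₀ φ₀)
    (hkin : ∀ z ∈ bdrySlab n T, dt (bdrySlab n T) φ z = vC (U (bdryL n z)) ⬝ᵥ normalN T φ z) :
    ∀ z ∈ bdrySlab n T, dt (bdrySlab n T) φ z = ν (bdryL n z) ⬝ᵥ normalN T φ z := fun z hz => by
  rw [hkin z hz, bdryL_apply, sol.ν_bdry z.1 hz.1]

/-- The constraints on a vacuum field `F` whose evolution is `∂ₜF + ∇·Ψ + (∇·F) ν = 0`. -/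
theorem IsSolution.preserved_vacuum_divFree (hT : 0 < T)
    (hχ : IsCutoff χ) (sol : IsSolution ε T c χ Am B U u φ ν U₀ u₀ φ₀)
    (hkin : ∀ z ∈ bdrySlab n T, dt (bdrySlab n T) φ z = vC (U (bdryL n z)) ⬝ᵥ normalN T φ z)
    {F : ℝ × (Fin (n + 1) → ℝ) → Fin (n + 1) → ℝ}
    {Ψ : Fin (n + 1) → Fin (n + 1) → ℝ × (Fin (n + 1) → ℝ) → ℝ}
    (hF : ∀ i, ContDiffOn ℝ 2 (fun z => F z i) (slab n T))
    (hΨ : ∀ i j, ContDiffOn ℝ 2 (Ψ i j) (slab n T)) (hanti : ∀ i j z, Ψ i j z = -Ψ j i z)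
    (heq : ∀ t ∈ Icc 0 T, ∀ x ∈ halfSpace n, ∀ i,
      dtL (slab n T) (lift χ φ (-1)) (fun y => F y i) (t, x)
      + ∑ j, dxL (slab n T) (lift χ φ (-1)) j (Ψ j i) (t, x)
      + (∑ j, dxL (slab n T) (lift χ φ (-1)) j (fun y => F y j) (t, x)) * ν (t, x) i = 0) :
    Preserved T (DivFreeAt T (lift χ φ (-1)) F) :=
  have hν := contDiffOn_pi.1 sol.smooth_ν
  preserved_divFreeAt hT hχ sol.smooth_φ sol.φ_le (by norm_num) hF hΨ hν (sol.abs_ν_le hT)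
    (sol.kinematic_ν hkin) hanti
    (conservation_on_slab hT hχ sol.smooth_φ sol.φ_le (by norm_num) hF hΨ hν heq)

/-- Here `β = 0`, so the boundary transport equation reduces to `∂ₜ(F·N) = 0`: the normal component
is constant in time. -/
theorem IsSolution.preserved_vacuum_tangent (hT : 0 < T)
    (hχ : IsCutoff χ) (sol : IsSolution ε T c χ Am B U u φ ν U₀ u₀ φ₀)
    (hkin : ∀ z ∈ bdrySlab n T, dt (bdrySlab n T) φ z = vC (U (bdryL n z)) ⬝ᵥ normalN T φ z)
    {F : ℝ × (Fin (n + 1) → ℝ) → Fin (n + 1) → ℝ}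
    {Ψ : Fin (n + 1) → Fin (n + 1) → ℝ × (Fin (n + 1) → ℝ) → ℝ}
    (hF : ∀ i, ContDiffOn ℝ 2 (fun z => F z i) (slab n T))
    (hΨ : ∀ i j, ContDiffOn ℝ 2 (Ψ i j) (slab n T)) (hanti : ∀ i j z, Ψ i j z = -Ψ j i z)
    (heq : ∀ t ∈ Icc 0 T, ∀ x ∈ halfSpace n, ∀ i,
      dtL (slab n T) (lift χ φ (-1)) (fun y => F y i) (t, x)
      + ∑ j, dxL (slab n T) (lift χ φ (-1)) j (Ψ j i) (t, x)
      + (∑ j, dxL (slab n T) (lift χ φ (-1)) j (fun y => F y j) (t, x)) * ν (t, x) i = 0)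
    (htan : ∀ z ∈ bdrySlab n T, ∀ j : Fin n, ∑ i, Ψ j.succ i (bdryL n z) * normalN T φ z i
      = -F (bdryL n z) j.succ * dt (bdrySlab n T) φ z) :
    Preserved T (TangentAt T φ F) :=
  have hν := contDiffOn_pi.1 sol.smooth_ν
  preserved_tangentAt hT hχ sol.smooth_φ (by norm_num) le_rfl
    (β := fun _ _ => 0) (fun i => (hF i).of_le (by norm_num))
    (fun i j => (hΨ i j).of_le (by norm_num)) (fun _ => contDiffOn_const)
    (fun _ _ _ => by simp) (sol.kinematic_ν hkin) hanti
    (fun z hz j => by rw [htan z hz j]; ring)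
    (conservation_on_slab hT hχ sol.smooth_φ sol.φ_le (by norm_num) hF hΨ hν heq)

end Solution

/-! ### The vacuum fields for `d = 3` and `d = 2` -/

/-- The antisymmetric matrix field with divergence `∇ × w`. -/
def crossField {X : Type*} (w : X → Fin 3 → ℝ) (j i : Fin 3) (z : X) : ℝ :=
  !![0, -w z 2, w z 1; w z 2, 0, -w z 0; -w z 1, w z 0, 0] j i

/-- The antisymmetric matrix field with divergence `(∂₂w, -∂₁w)`. -/
def rotField {X : Type*} (w : X → ℝ) (j i : Fin 2) (z : X) : ℝ :=
  !![0, -w z; w z, 0] j i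

theorem crossField_anti {X : Type*} (w : X → Fin 3 → ℝ) (i j : Fin 3) (z : X) :
    crossField w i j z = -crossField w j i z := by
  fin_cases i <;> fin_cases j <;> simp [crossField]

theorem rotField_anti {X : Type*} (w : X → ℝ) (i j : Fin 2) (z : X) :
    rotField w i j z = -rotField w j i z := by
  fin_cases i <;> fin_cases j <;> simp [rotField]

theorem contDiffOn_crossField {E : Type*} [NormedAddCommGroup E] [NormedSpace ℝ E] {S : Set E}
    {w : E → Fin 3 → ℝ} (h : ∀ i, ContDiffOn ℝ 2 (fun z => w z i) S) (i j : Fin 3) :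
    ContDiffOn ℝ 2 (crossField w i j) S := by
  have h0 := h 0
  have h1 := h 1
  have h2 := h 2
  fin_cases i <;> fin_cases j <;>
    first
      | exact contDiffOn_const
      | exact h0
      | exact h1
      | exact h2
      | exact h0.neg
      | exact h1.neg
      | exact h2.neg

theorem contDiffOn_rotField {E : Type*} [NormedAddCommGroup E] [NormedSpace ℝ E] {S : Set E}
    {w : E → ℝ} (h : ContDiffOn ℝ 2 w S) (i j : Fin 2) :
    ContDiffOn ℝ 2 (rotField w i j) S := by
  fin_cases i <;> fin_cases j <;>
    first
      | exact contDiffOn_const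
      | exact h
      | exact h.neg

theorem pd_crossField {E : Type*} [NormedAddCommGroup E] [NormedSpace ℝ E] {S : Set E} {g : E → ℝ}
    {w : E → Fin 3 → ℝ} {z : E} (hS : UniqueDiffOn ℝ S) (hz : z ∈ S) (e a : E) (κ : ℝ)
    (j i : Fin 3) : pd S g e a κ (crossField w j i) z
      = crossField (fun _ k => pd S g e a κ (fun y => w y k) z) j i z := by
  have hn : ∀ k, pd S g e a κ (fun y => -w y k) z = -pd S g e a κ (fun y => w y k) z :=
    fun k => pd_neg hS hz _ _ _
  have h0 : pd S g e a κ (fun _ => (0 : ℝ)) z = 0 := pd_zero _ _ _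
  fin_cases i <;> fin_cases j <;> first | exact h0 | rfl | exact hn _

theorem pd_rotField {E : Type*} [NormedAddCommGroup E] [NormedSpace ℝ E] {S : Set E} {g : E → ℝ}
    {w : E → ℝ} {z : E} (hS : UniqueDiffOn ℝ S) (hz : z ∈ S) (e a : E) (κ : ℝ)
    (j i : Fin 2) : pd S g e a κ (rotField w j i) z
      = rotField (fun _ => pd S g e a κ w z) j i z := by
  have hn : pd S g e a κ (fun y => -w y) z = -pd S g e a κ w z := pd_neg hS hz _ _ _
  have h0 : pd S g e a κ (fun _ => (0 : ℝ)) z = 0 := pd_zero _ _ _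
  fin_cases i <;> fin_cases j <;> first | exact h0 | rfl | exact hn

theorem preserved_dim_three {ε T : ℝ} (hε : 0 < ε) (hT : 0 < T)
    {c : Constitutive} (hc : c.Admissible ε) {χ : ℝ → ℝ} (hχ : IsCutoff χ)
    {U : ℝ × (Fin 3 → ℝ) → PIdx 3 → ℝ} {u : ℝ × (Fin 3 → ℝ) → Fin 6 → ℝ}
    {φ : ℝ × (Fin 2 → ℝ) → ℝ} {ν : ℝ × (Fin 3 → ℝ) → Fin 3 → ℝ}
    {U₀ : (Fin 3 → ℝ) → PIdx 3 → ℝ} {u₀ : (Fin 3 → ℝ) → Fin 6 → ℝ} {φ₀ : (Fin 2 → ℝ) → ℝ}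
    (sol : IsSolution ε T c χ (Aminus3 ε) (bdryOp3 ε) U u φ ν U₀ u₀ φ₀) :
    Preserved T (DivFreeAt T (lift χ φ 1) fun z => HC (U z)) ∧
    Preserved T (DivFreeAt T (lift χ φ (-1)) fun z => h3 (u z)) ∧
    Preserved T (TangentAt T φ fun z => HC (U z)) ∧
    Preserved T (TangentAt T φ fun z => h3 (u z)) ∧
    Preserved T (DivFreeAt T (lift χ φ (-1)) fun z => e3 (u z)) := by
  have hS := uniqueDiffOn_slab (n := 2) hT
  have hε' : ε ≠ 0 := hε.ne'
  have hN1 : ∀ z, normalN T φ z 1 = -dx (bdrySlab 2 T) 0 φ z := fun _ => rfl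
  have hN2 : ∀ z, normalN T φ z 2 = -dx (bdrySlab 2 T) 1 φ z := fun _ => rfl
  have hN0 : ∀ z, normalN T φ z 0 = 1 := fun _ => rfl
  have hkin : ∀ z ∈ bdrySlab 2 T,
      dt (bdrySlab 2 T) φ z = vC (U (bdryL 2 z)) ⬝ᵥ normalN T φ z := by
    intro z hz
    have h := congrFun (sol.boundary z.1 hz.1 z.2) 0
    simp only [bdryOp3, Matrix.cons_val_zero, Pi.zero_apply] at h
    rw [bdryL_apply]
    simp only [dotProduct, Fin.sum_univ_three, hN0, hN1, hN2]
    linarith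
  have hu := contDiffOn_pi.1 sol.smooth_u
  have hh : ∀ i, ContDiffOn ℝ 2 (fun z => h3 (u z) i) (slab 2 T) := by
    intro i; fin_cases i
    exacts [hu 0, hu 1, hu 2]
  have he : ∀ i, ContDiffOn ℝ 2 (fun z => e3 (u z) i) (slab 2 T) := by
    intro i; fin_cases i
    exacts [hu 3, hu 4, hu 5]
  -- Division by `ε` normalizes the time derivatives; the minus sign for `e` is that of `-∇ × h`.
  set Ψh := crossField (fun z i => ε⁻¹ * e3 (u z) i) with hΨhdef
  set Ψe := crossField (fun z i => -ε⁻¹ * h3 (u z) i) with hΨedef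
  have hΨh : ∀ i j, ContDiffOn ℝ 2 (Ψh i j) (slab 2 T) :=
    contDiffOn_crossField fun i => contDiffOn_const.mul (he i)
  have hΨe : ∀ i j, ContDiffOn ℝ 2 (Ψe i j) (slab 2 T) :=
    contDiffOn_crossField fun i => contDiffOn_const.mul (hh i)
  have heqh : ∀ t ∈ Icc 0 T, ∀ x ∈ halfSpace 2, ∀ i,
      dtL (slab 2 T) (lift χ φ (-1)) (fun y => h3 (u y) i) (t, x)
      + ∑ j, dxL (slab 2 T) (lift χ φ (-1)) j (Ψh j i) (t, x)
      + (∑ j, dxL (slab 2 T) (lift χ φ (-1)) j (fun y => h3 (u y) j) (t, x)) * ν (t, x) i = 0 := by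
    intro t ht x hx i
    have hz : (t, x) ∈ slab 2 T := ⟨ht, halfSpace_subset_closedHalfSpace hx⟩
    have hk := sol.vacuum_eq hT hχ ht hx
    simp only [hΨhdef, dxL, pd_crossField hS hz]
    simp only [pd_const_mul hS hz ((he _).differentiableOn (by norm_num) _ hz)]
    apply mul_left_cancel₀ hε'
    rw [mul_zero]
    fin_cases i
    · refine Eq.trans ?_ (hk 0)
      simp [Fin.sum_univ_succ, Aminus3, crossField, h3, e3, dxL]
      field_simp
      ring
    · refine Eq.trans ?_ (hk 1)
      simp [Fin.sum_univ_succ, Aminus3, crossField, h3, e3, dxL]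
      field_simp
      ring
    · refine Eq.trans ?_ (hk 2)
      simp [Fin.sum_univ_succ, Aminus3, crossField, h3, e3, dxL]
      field_simp
      ring
  have heqe : ∀ t ∈ Icc 0 T, ∀ x ∈ halfSpace 2, ∀ i,
      dtL (slab 2 T) (lift χ φ (-1)) (fun y => e3 (u y) i) (t, x)
      + ∑ j, dxL (slab 2 T) (lift χ φ (-1)) j (Ψe j i) (t, x)
      + (∑ j, dxL (slab 2 T) (lift χ φ (-1)) j (fun y => e3 (u y) j) (t, x)) * ν (t, x) i = 0 := by
    intro t ht x hx i
    have hz : (t, x) ∈ slab 2 T := ⟨ht, halfSpace_subset_closedHalfSpace hx⟩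
    have hk := sol.vacuum_eq hT hχ ht hx
    simp only [hΨedef, dxL, pd_crossField hS hz]
    simp only [pd_const_mul hS hz ((hh _).differentiableOn (by norm_num) _ hz)]
    apply mul_left_cancel₀ hε'
    rw [mul_zero]
    fin_cases i
    · refine Eq.trans ?_ (hk 3)
      simp [Fin.sum_univ_succ, Aminus3, crossField, h3, e3, dxL]
      field_simp
      ring
    · refine Eq.trans ?_ (hk 4)
      simp [Fin.sum_univ_succ, Aminus3, crossField, h3, e3, dxL]
      field_simp
      ring
    · refine Eq.trans ?_ (hk 5)
      simp [Fin.sum_univ_succ, Aminus3, crossField, h3, e3, dxL]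
      field_simp
      ring
  obtain ⟨hH1, hH2⟩ := sol.preserved_plasma hε hT hc hχ hkin
  refine ⟨hH1, sol.preserved_vacuum_divFree hT hχ hkin hh hΨh (crossField_anti _) heqh, hH2,
    sol.preserved_vacuum_tangent hT hχ hkin hh hΨh (crossField_anti _) heqh ?_,
    sol.preserved_vacuum_divFree hT hχ hkin he hΨe (crossField_anti _) heqe⟩
  -- `Ψh` acts as `ε⁻¹ e ×`, so the tangential components of `ε⁻¹ e × N` are needed. The jump
  -- conditions on `e` say that these are `-∂ₜφ h₂` and `-∂ₜφ h₃`.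
  intro z hz j
  have h2 := congrFun (sol.boundary z.1 hz.1 z.2) 2
  have h3' := congrFun (sol.boundary z.1 hz.1 z.2) 3
  simp [bdryOp3] at h2 h3'
  rw [bdryL_apply]
  fin_cases j
  · simp [Fin.sum_univ_three, hN0, hN1, hN2, hΨhdef, crossField]
    field_simp
    linarith
  · simp [Fin.sum_univ_three, hN0, hN1, hN2, hΨhdef, crossField]
    field_simp
    linarith

theorem preserved_dim_two {ε T : ℝ} (hε : 0 < ε) (hT : 0 < T)
    {c : Constitutive} (hc : c.Admissible ε) {χ : ℝ → ℝ} (hχ : IsCutoff χ)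
    {U : ℝ × (Fin 2 → ℝ) → PIdx 2 → ℝ} {u : ℝ × (Fin 2 → ℝ) → Fin 3 → ℝ}
    {φ : ℝ × (Fin 1 → ℝ) → ℝ} {ν : ℝ × (Fin 2 → ℝ) → Fin 2 → ℝ}
    {U₀ : (Fin 2 → ℝ) → PIdx 2 → ℝ} {u₀ : (Fin 2 → ℝ) → Fin 3 → ℝ} {φ₀ : (Fin 1 → ℝ) → ℝ}
    (sol : IsSolution ε T c χ (Aminus2 ε) (bdryOp2 ε) U u φ ν U₀ u₀ φ₀) :
    Preserved T (DivFreeAt T (lift χ φ 1) fun z => HC (U z)) ∧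
    Preserved T (DivFreeAt T (lift χ φ (-1)) fun z => h2 (u z)) ∧
    Preserved T (TangentAt T φ fun z => HC (U z)) ∧
    Preserved T (TangentAt T φ fun z => h2 (u z)) := by
  have hS := uniqueDiffOn_slab (n := 1) hT
  have hε' : ε ≠ 0 := hε.ne'
  have hN1 : ∀ z, normalN T φ z 1 = -dx (bdrySlab 1 T) 0 φ z := fun _ => rfl
  have hN0 : ∀ z, normalN T φ z 0 = 1 := fun _ => rfl
  have hkin : ∀ z ∈ bdrySlab 1 T,
      dt (bdrySlab 1 T) φ z = vC (U (bdryL 1 z)) ⬝ᵥ normalN T φ z := by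
    intro z hz
    have h := congrFun (sol.boundary z.1 hz.1 z.2) 0
    simp only [bdryOp2, Matrix.cons_val_zero, Pi.zero_apply] at h
    rw [bdryL_apply]
    simp only [dotProduct, Fin.sum_univ_two, hN0, hN1]
    linarith
  have hu := contDiffOn_pi.1 sol.smooth_u
  have hh : ∀ i, ContDiffOn ℝ 2 (fun z => h2 (u z) i) (slab 1 T) := by
    intro i; fin_cases i
    exacts [hu 0, hu 1]
  set Ψ := rotField (fun z => ε⁻¹ * u z 2) with hΨdef
  have hΨ : ∀ i j, ContDiffOn ℝ 2 (Ψ i j) (slab 1 T) :=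
    contDiffOn_rotField (contDiffOn_const.mul (hu 2))
  have heq : ∀ t ∈ Icc 0 T, ∀ x ∈ halfSpace 1, ∀ i,
      dtL (slab 1 T) (lift χ φ (-1)) (fun y => h2 (u y) i) (t, x)
      + ∑ j, dxL (slab 1 T) (lift χ φ (-1)) j (Ψ j i) (t, x)
      + (∑ j, dxL (slab 1 T) (lift χ φ (-1)) j (fun y => h2 (u y) j) (t, x)) * ν (t, x) i = 0 := by
    intro t ht x hx i
    have hz : (t, x) ∈ slab 1 T := ⟨ht, halfSpace_subset_closedHalfSpace hx⟩
    have hk := sol.vacuum_eq hT hχ ht hx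
    simp only [hΨdef, dxL, pd_rotField hS hz]
    simp only [pd_const_mul hS hz ((hu 2).differentiableOn (by norm_num) _ hz)]
    apply mul_left_cancel₀ hε'
    rw [mul_zero]
    fin_cases i
    · refine Eq.trans ?_ (hk 0)
      simp [Fin.sum_univ_succ, Aminus2, rotField, h2, dxL]
      field_simp
      ring
    · refine Eq.trans ?_ (hk 1)
      simp [Fin.sum_univ_succ, Aminus2, rotField, h2, dxL]
      field_simp
      ring
  obtain ⟨hH1, hH2⟩ := sol.preserved_plasma hε hT hc hχ hkin
  refine ⟨hH1, sol.preserved_vacuum_divFree hT hχ hkin hh hΨ (rotField_anti _) heq, hH2,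
    sol.preserved_vacuum_tangent hT hχ hkin hh hΨ (rotField_anti _) heq ?_⟩
  -- The single tangential row of `Ψ` pairs with `N₁ = 1` to give `ε⁻¹ e`, which is `-∂ₜφ h₂` by the
  -- boundary condition.
  intro z hz j
  have h2' := congrFun (sol.boundary z.1 hz.1 z.2) 2
  simp [bdryOp2, e2] at h2'
  rw [bdryL_apply]
  fin_cases j
  simp [Fin.sum_univ_two, hN0, hN1, hΨdef, rotField]
  field_simp
  linarith

end PlasmaVacuum

end

theorem proposition2p1 (ε T : ℝ) (hε : 0 < ε) (hT : 0 < T)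
    (c : PlasmaVacuum.Constitutive) (hc : c.Admissible ε)
    (χ : ℝ → ℝ) (hχ : PlasmaVacuum.IsCutoff χ) :
    (∀ (U : ℝ × (Fin 3 → ℝ) → PlasmaVacuum.PIdx 3 → ℝ) (u : ℝ × (Fin 3 → ℝ) → Fin 6 → ℝ)
        (φ : ℝ × (Fin 2 → ℝ) → ℝ) (ν : ℝ × (Fin 3 → ℝ) → Fin 3 → ℝ)
        (U₀ : (Fin 3 → ℝ) → PlasmaVacuum.PIdx 3 → ℝ) (u₀ : (Fin 3 → ℝ) → Fin 6 → ℝ)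
        (φ₀ : (Fin 2 → ℝ) → ℝ),
      PlasmaVacuum.IsSolution ε T c χ (PlasmaVacuum.Aminus3 ε) (PlasmaVacuum.bdryOp3 ε)
          U u φ ν U₀ u₀ φ₀ →
        PlasmaVacuum.Preserved T (PlasmaVacuum.DivFreeAt T (PlasmaVacuum.lift χ φ 1)
            fun z => PlasmaVacuum.HC (U z)) ∧
        PlasmaVacuum.Preserved T (PlasmaVacuum.DivFreeAt T (PlasmaVacuum.lift χ φ (-1))
            fun z => PlasmaVacuum.h3 (u z)) ∧
        PlasmaVacuum.Preserved T (PlasmaVacuum.TangentAt T φ fun z => PlasmaVacuum.HC (U z)) ∧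
        PlasmaVacuum.Preserved T (PlasmaVacuum.TangentAt T φ fun z => PlasmaVacuum.h3 (u z)) ∧
        PlasmaVacuum.Preserved T (PlasmaVacuum.DivFreeAt T (PlasmaVacuum.lift χ φ (-1))
            fun z => PlasmaVacuum.e3 (u z))) ∧
    (∀ (U : ℝ × (Fin 2 → ℝ) → PlasmaVacuum.PIdx 2 → ℝ) (u : ℝ × (Fin 2 → ℝ) → Fin 3 → ℝ)
        (φ : ℝ × (Fin 1 → ℝ) → ℝ) (ν : ℝ × (Fin 2 → ℝ) → Fin 2 → ℝ)
        (U₀ : (Fin 2 → ℝ) → PlasmaVacuum.PIdx 2 → ℝ) (u₀ : (Fin 2 → ℝ) → Fin 3 → ℝ)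
        (φ₀ : (Fin 1 → ℝ) → ℝ),
      PlasmaVacuum.IsSolution ε T c χ (PlasmaVacuum.Aminus2 ε) (PlasmaVacuum.bdryOp2 ε)
          U u φ ν U₀ u₀ φ₀ →
        PlasmaVacuum.Preserved T (PlasmaVacuum.DivFreeAt T (PlasmaVacuum.lift χ φ 1)
            fun z => PlasmaVacuum.HC (U z)) ∧
        PlasmaVacuum.Preserved T (PlasmaVacuum.DivFreeAt T (PlasmaVacuum.lift χ φ (-1))
            fun z => PlasmaVacuum.h2 (u z)) ∧
        PlasmaVacuum.Preserved T (PlasmaVacuum.TangentAt T φ fun z => PlasmaVacuum.HC (U z)) ∧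
        PlasmaVacuum.Preserved T (PlasmaVacuum.TangentAt T φ fun z => PlasmaVacuum.h2 (u z))) :=
  ⟨fun _ _ _ _ _ _ _ sol => PlasmaVacuum.preserved_dim_three hε hT hc hχ sol,
    fun _ _ _ _ _ _ _ sol => PlasmaVacuum.preserved_dim_two hε hT hc hχ sol⟩
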